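/- Let $A,C\in\mathbb R^{n\times n}$, $B,D\in\mathbb R^{n\times m}$, and consider $$x_{k+1}=Ax_k+Bu_k+(Cx_k+Du_k)d_k+w_k ,$$ where $d_k\sim N(0,1)$, $w_k$ is a centred Gaussian vector with covariance $W\succeq 0$, $\mathrm E(d_iw_j)=0$ for all $i,j$, and the pairs $(d_k,w_k)$, $k\ge 0$, are independent. Initial states are square-integrable and independent of the noise. Let the one-step cost be $c(x,u)=x^\top Qx+u^\top Ru$ with symmetric $Q\succeq 0$, $R\succ 0$, and let $0\le\gamma<1$ be a discount factor. A measurable feedback policy $u_k=\pi_k(x_k)$ is admissible if there is a matrix $X\succeq 0$ such that, for every initial state, all $x_k$ are square-integrable and $\mathrm E(x_kx_k^\top)\to X$; a gain $L$ is admissible if the policy $u=Lx$ is. Let $V_\pi(\xi)=\mathrm E\sum_{i\ge 0}\gamma^i c(x_i,u_i)$ be the cost of $\pi$ from $x_0=\xi$, and let $V^*(\xi)$ be the infimum of $V_\pi(\xi)$ over all admissible $\pi$. The Q-function of a gain $L$ and the optimal Q-function are $$Q_L(\xi,\eta)=\mathrm E\,c(\xi,\eta)+\gamma V_L(x_1),\qquad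 Q^*(\xi,\eta)=\mathrm E\,c(\xi,\eta)+\gamma V^*(x_1),$$ where $x_1$ is the state reached from $x_0=\xi$ with the input $u_0=\eta$, and $V_L$, $V^*$ are evaluated with the noise from time $1$ on; here $(\xi,\eta)$ is any square-integrable pair independent of the noise. For $P\in\mathbb R^{n\times n}$ put $$H(P)=\begin{bmatrix}Q+\gamma A^\top PA+\gamma C^\top PC & \gamma A^\top PB+\gamma C^\top PD\\ \gamma B^\top PA+\gamma D^\top PC & R+\gamma B^\top PB+\gamma D^\top PD\end{bmatrix},\qquad L(P)=-H_{uu}(P)^{-1}H_{ux}(P).$$ Model-free Q-function policy iteration starts from an admissible gain $L^{(0)}$ and repeats, for $i=0,1,2,\dots$: (evaluation) $H^{(i)}$ is a symmetric matrix such that for every time $k$, and every square-integrable state $x_k$ and input $u_k$ (jointly independent of $(d_k,w_k)$), with $u_{k+1}=L^{(i)}x_{k+1}$, $$\mathrm E\Big(\begin{bmatrix}x_k\\u_k\end{bmatrix}^{\!\top}\! H^{(i)}\begin{bmatrix}x_k\\u_k\end{bmatrix}\Big)=\mathrm E\,c(x_k,u_k)+\gamma\,\mathrm E\Big(\begin{bmatrix}x_{k+1}\\u_{k+1}\end{bmatrix}^{\!\top}\!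 H^{(i)}\begin{bmatrix}x_{k+1}\\u_{k+1}\end{bmatrix}\Big)-\gamma\,\mathrm{tr}\Big(H^{(i)}\begin{bmatrix}I\\L^{(i)}\end{bmatrix}W\begin{bmatrix}I\\L^{(i)}\end{bmatrix}^{\!\top}\Big);$$ (improvement) $L^{(i+1)}=-(H^{(i)}_{uu})^{-1}H^{(i)}_{ux}$. Theorem. Suppose an admissible gain $L^{(0)}$ is given. Then the iteration is well defined: it produces exactly one pair of sequences $(L^{(i)})$, $(H^{(i)})$, and each $H^{(i)}_{uu}$ is positive definite. The stochastic algebraic Riccati equation $$P=H_{xx}(P)-H_{xu}(P)H_{uu}(P)^{-1}H_{ux}(P)$$ has a greatest positive semidefinite solution $P^*$; if $Q\succ 0$, then $P^*\succ 0$ and it is the only positive semidefinite solution. With $L^*=L(P^*)$ and $H^*=H(P^*)$, the following hold. 1. $V_{L^*}(\xi)\le V^*(\xi)=\mathrm E(\xi^\top P^*\xi)+\frac{\gamma}{1-\gamma}\mathrm{tr}(P^*W)$ for every initial state $\xi$. For every pair $(\xi,\eta)$, with $z=[\xi^\top\ \eta^\top]^\top$, $Q^*(\xi,\eta)=\mathrm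 E(z^\top H^*z)+\frac{\gamma}{1-\gamma}\mathrm{tr}\big(H^*\begin{bmatrix}I\\L^*\end{bmatrix}W\begin{bmatrix}I\\L^*\end{bmatrix}^\top\big)$, and the same identity holds for $Q^{(i)}:=Q_{L^{(i)}}$ with $H^{(i)}$, $L^{(i)}$ in place of $H^*$, $L^*$. 2. $\lim_{i\to\infty}L^{(i)}=L^*$ and $\lim_{i\to\infty}H^{(i)}=H^*$. Hence the policies $u^{(i)}=L^{(i)}x$ converge to $u^*=L^*x$ for every state $x$, and $Q^{(i)}(\xi,\eta)\to Q^*(\xi,\eta)$ for every pair $(\xi,\eta)$. -/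

import Mathlib

open MeasureTheory ProbabilityTheory Filter Topology
open scoped ENNReal Matrix

noncomputable section

/-- The data of the discounted stochastic linear-quadratic problem
`x_{k+1} = A x_k + B u_k + (C x_k + D u_k) d_k + w_k` with `n` states and `m` inputs:
system matrices, additive noise covariance `W`, cost weights `Q`, `R`, discount factor `γ`. -/
structure LQRData (n m : ℕ) where
  A : Matrix (Fin n) (Fin n) ℝ
  B : Matrix (Fin n) (Fin m) ℝ
  C : Matrix (Fin n) (Fin n) ℝ
  D : Matrix (Fin n) (Fin m) ℝ
  W : Matrix (Fin n) (Fin n) ℝ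
  Q : Matrix (Fin n) (Fin n) ℝ
  R : Matrix (Fin m) (Fin m) ℝ
  γ : ℝ

/-- `(d_k, w_k)` is a noise sequence: `d_k` is standard Gaussian, `w_k` is a (possibly degenerate)
centred Gaussian vector with covariance `W`, `d_i` and `w_j` are uncorrelated, and the pairs
`(d_k, w_k)` are independent over time. -/
structure IsNoise {Ω : Type*} [MeasurableSpace Ω] (P : Measure Ω) {n : ℕ}
    (W : Matrix (Fin n) (Fin n) ℝ) (d : ℕ → Ω → ℝ) (w : ℕ → Ω → Fin n → ℝ) : Prop where
  measurable_d : ∀ k, Measurable (d k)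
  measurable_w : ∀ k, Measurable (w k)
  law_d : ∀ k, P.map (d k) = gaussianReal 0 1
  gaussian_w : ∀ k, HasGaussianLaw (w k) P
  mean_w : ∀ k i, ∫ ω, w k ω i ∂P = 0
  cov_w : ∀ k i j, ∫ ω, w k ω i * w k ω j ∂P = W i j
  uncorrelated : ∀ k l i, ∫ ω, d k ω * w l ω i ∂P = 0
  indep : iIndepFun (fun k ω => (d k ω, w k ω)) P

/-- A square-integrable random element (an initial state, or a pair of an initial state and an
initial input) that is independent of the whole noise sequence. -/
def IsInitial {Ω : Type*} [MeasurableSpace Ω] (P : Measure Ω) {n : ℕ}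
    (d : ℕ → Ω → ℝ) (w : ℕ → Ω → Fin n → ℝ)
    {E : Type*} [NormedAddCommGroup E] [MeasurableSpace E] (ξ : Ω → E) : Prop :=
  Measurable ξ ∧ MemLp ξ 2 P ∧ IndepFun ξ (fun ω k => (d k ω, w k ω)) P

/-- The matrix `E(x xᵀ)`. -/
def secondMoment {Ω : Type*} [MeasurableSpace Ω] (P : Measure Ω) {n : ℕ} (x : Ω → Fin n → ℝ) :
    Matrix (Fin n) (Fin n) ℝ :=
  Matrix.of fun i j => ∫ ω, x ω i * x ω j ∂P

namespace LQRData

variable {n m : ℕ} (S : LQRData n m)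

/-- The next state from state `x`, input `u` and noise values `d`, `w`. -/
def step (x : Fin n → ℝ) (u : Fin m → ℝ) (d : ℝ) (w : Fin n → ℝ) : Fin n → ℝ :=
  S.A *ᵥ x + S.B *ᵥ u + d • (S.C *ᵥ x + S.D *ᵥ u) + w

/-- The one-step cost `xᵀ Q x + uᵀ R u`. -/
def cost (x : Fin n → ℝ) (u : Fin m → ℝ) : ℝ :=
  x ⬝ᵥ (S.Q *ᵥ x) + u ⬝ᵥ (S.R *ᵥ u)

/-- The closed-loop state process under the feedback policy `u_k = π_k(x_k)`, started at `ξ`. -/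
def traj {Ω : Type*} (d : ℕ → Ω → ℝ) (w : ℕ → Ω → Fin n → ℝ)
    (π : ℕ → (Fin n → ℝ) → (Fin m → ℝ)) (ξ : Ω → Fin n → ℝ) : ℕ → Ω → Fin n → ℝ
  | 0 => ξ
  | k + 1 => fun ω =>
      S.step (traj d w π ξ k ω) (π k (traj d w π ξ k ω)) (d k ω) (w k ω)

/-- The stationary linear policy `u = L x`. -/
def linearPolicy (L : Matrix (Fin m) (Fin n) ℝ) : ℕ → (Fin n → ℝ) → (Fin m → ℝ) :=
  fun _ x => L *ᵥ x

/-- Admissibility: the closed loop is asymptotically square stationary, i.e. `E(x_k x_kᵀ)`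
converges to a matrix that does not depend on the initial state. -/
def Admissible {Ω : Type*} [MeasurableSpace Ω] (P : Measure Ω)
    (d : ℕ → Ω → ℝ) (w : ℕ → Ω → Fin n → ℝ) (π : ℕ → (Fin n → ℝ) → (Fin m → ℝ)) : Prop :=
  (∀ k, Measurable (π k)) ∧
  ∃ X : Matrix (Fin n) (Fin n) ℝ, X.PosSemidef ∧
    ∀ ξ : Ω → Fin n → ℝ, IsInitial P d w ξ →
      (∀ k, MemLp (S.traj d w π ξ k) 2 P) ∧
      Tendsto (fun k => secondMoment P (S.traj d w π ξ k)) atTop (𝓝 X)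

/-- The discounted cost `E ∑ γ^i c(x_i, u_i)` of the policy `π` from the initial state `ξ`. -/
def V {Ω : Type*} [MeasurableSpace Ω] (P : Measure Ω)
    (d : ℕ → Ω → ℝ) (w : ℕ → Ω → Fin n → ℝ) (π : ℕ → (Fin n → ℝ) → (Fin m → ℝ))
    (ξ : Ω → Fin n → ℝ) : ℝ≥0∞ :=
  ∫⁻ ω, ∑' i : ℕ, ENNReal.ofReal
    (S.γ ^ i * S.cost (S.traj d w π ξ i ω) (π i (S.traj d w π ξ i ω))) ∂P

/-- The optimal cost over all admissible policies. -/
def Vstar {Ω : Type*} [MeasurableSpace Ω] (P : Measure Ω)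
    (d : ℕ → Ω → ℝ) (w : ℕ → Ω → Fin n → ℝ) (ξ : Ω → Fin n → ℝ) : ℝ≥0∞ :=
  ⨅ (π : ℕ → (Fin n → ℝ) → (Fin m → ℝ)) (_ : S.Admissible P d w π), S.V P d w π ξ

/-- The Q-function of the gain `L`: apply the arbitrary input `η` in the state `ξ` now, and
`u = L x` from the next step on. -/
def Qfun {Ω : Type*} [MeasurableSpace Ω] (P : Measure Ω)
    (d : ℕ → Ω → ℝ) (w : ℕ → Ω → Fin n → ℝ) (L : Matrix (Fin m) (Fin n) ℝ)
    (ξ : Ω → Fin n → ℝ) (η : Ω → Fin m → ℝ) : ℝ≥0∞ :=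
  ∫⁻ ω, ENNReal.ofReal (S.cost (ξ ω) (η ω)) ∂P +
    ENNReal.ofReal S.γ * S.V P (fun k => d (k + 1)) (fun k => w (k + 1)) (linearPolicy L)
      (fun ω => S.step (ξ ω) (η ω) (d 0 ω) (w 0 ω))

/-- The optimal Q-function: apply `η` in the state `ξ` now, and act optimally afterwards. -/
def Qstar {Ω : Type*} [MeasurableSpace Ω] (P : Measure Ω)
    (d : ℕ → Ω → ℝ) (w : ℕ → Ω → Fin n → ℝ)
    (ξ : Ω → Fin n → ℝ) (η : Ω → Fin m → ℝ) : ℝ≥0∞ :=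
  ∫⁻ ω, ENNReal.ofReal (S.cost (ξ ω) (η ω)) ∂P +
    ENNReal.ofReal S.γ * S.Vstar P (fun k => d (k + 1)) (fun k => w (k + 1))
      (fun ω => S.step (ξ ω) (η ω) (d 0 ω) (w 0 ω))

/-- The quadratic form `[x; u]ᵀ H [x; u]`. -/
def quad (H : Matrix (Fin n ⊕ Fin m) (Fin n ⊕ Fin m) ℝ) (x : Fin n → ℝ) (u : Fin m → ℝ) : ℝ :=
  Sum.elim x u ⬝ᵥ (H *ᵥ Sum.elim x u)

/-- The number `tr(H [I; L] W [I; L]ᵀ)`. -/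
def noiseTrace (H : Matrix (Fin n ⊕ Fin m) (Fin n ⊕ Fin m) ℝ) (L : Matrix (Fin m) (Fin n) ℝ) : ℝ :=
  (H * (Matrix.fromRows 1 L * S.W * (Matrix.fromRows 1 L)ᵀ)).trace

/-- Policy evaluation: the symmetric matrix `H` satisfies the Bellman equation of the Q-function
of `u = L x`, at every time `k`, for every square-integrable state `ξ` and input `η` at time `k`
(independent of the noise at time `k`), the input at time `k + 1` being `L x_{k+1}`. -/
def PolicyEvaluation {Ω : Type*} [MeasurableSpace Ω] (P : Measure Ω)
    (d : ℕ → Ω → ℝ) (w : ℕ → Ω → Fin n → ℝ) (L : Matrix (Fin m) (Fin n) ℝ)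
    (H : Matrix (Fin n ⊕ Fin m) (Fin n ⊕ Fin m) ℝ) : Prop :=
  H.IsSymm ∧
  ∀ (k : ℕ) (ξ : Ω → Fin n → ℝ) (η : Ω → Fin m → ℝ),
    Measurable ξ → Measurable η → MemLp ξ 2 P → MemLp η 2 P →
    IndepFun (fun ω => (ξ ω, η ω)) (fun ω => (d k ω, w k ω)) P →
    ∫ ω, quad H (ξ ω) (η ω) ∂P =
      ∫ ω, S.cost (ξ ω) (η ω) ∂P
      + S.γ * ∫ ω, quad H (S.step (ξ ω) (η ω) (d k ω) (w k ω))
          (L *ᵥ S.step (ξ ω) (η ω) (d k ω) (w k ω)) ∂P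
      - S.γ * S.noiseTrace H L

/-- `L^{(i)}`, `H^{(i)}` are the sequences produced by the model-free Q-function policy iteration
from the initial gain `L0`. -/
structure IsModelFreePI {Ω : Type*} [MeasurableSpace Ω] (P : Measure Ω)
    (d : ℕ → Ω → ℝ) (w : ℕ → Ω → Fin n → ℝ) (L0 : Matrix (Fin m) (Fin n) ℝ)
    (L : ℕ → Matrix (Fin m) (Fin n) ℝ)
    (H : ℕ → Matrix (Fin n ⊕ Fin m) (Fin n ⊕ Fin m) ℝ) : Prop where
  init : L 0 = L0
  evaluation : ∀ i, S.PolicyEvaluation P d w (L i) (H i)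
  improvement : ∀ i, L (i + 1) = -((H i).toBlocks₂₂⁻¹ * (H i).toBlocks₂₁)

/-- The block `R + γ Bᵀ P B + γ Dᵀ P D`. -/
def Huu (P : Matrix (Fin n) (Fin n) ℝ) : Matrix (Fin m) (Fin m) ℝ :=
  S.R + S.γ • (S.Bᵀ * P * S.B) + S.γ • (S.Dᵀ * P * S.D)

/-- The block `γ Bᵀ P A + γ Dᵀ P C`. -/
def Hux (P : Matrix (Fin n) (Fin n) ℝ) : Matrix (Fin m) (Fin n) ℝ :=
  S.γ • (S.Bᵀ * P * S.A) + S.γ • (S.Dᵀ * P * S.C)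

/-- The block `γ Aᵀ P B + γ Cᵀ P D`. -/
def Hxu (P : Matrix (Fin n) (Fin n) ℝ) : Matrix (Fin n) (Fin m) ℝ :=
  S.γ • (S.Aᵀ * P * S.B) + S.γ • (S.Cᵀ * P * S.D)

/-- The block `Q + γ Aᵀ P A + γ Cᵀ P C`. -/
def Hxx (P : Matrix (Fin n) (Fin n) ℝ) : Matrix (Fin n) (Fin n) ℝ :=
  S.Q + S.γ • (S.Aᵀ * P * S.A) + S.γ • (S.Cᵀ * P * S.C)

/-- The Q-function kernel that belongs to the cost kernel `P`. -/
def kernelOf (P : Matrix (Fin n) (Fin n) ℝ) : Matrix (Fin n ⊕ Fin m) (Fin n ⊕ Fin m) ℝ :=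
  Matrix.fromBlocks (S.Hxx P) (S.Hxu P) (S.Hux P) (S.Huu P)

/-- The gain `-(R + γ Bᵀ P B + γ Dᵀ P D)⁻¹ (γ Bᵀ P A + γ Dᵀ P C)`. -/
def gainOf (P : Matrix (Fin n) (Fin n) ℝ) : Matrix (Fin m) (Fin n) ℝ :=
  -((S.Huu P)⁻¹ * S.Hux P)

/-- The stochastic algebraic Riccati equation. -/
def SARE (P : Matrix (Fin n) (Fin n) ℝ) : Prop :=
  P = S.Hxx P - S.Hxu P * (S.Huu P)⁻¹ * S.Hux P

/-- `P` is the greatest positive semidefinite solution of the Riccati equation. -/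
def IsGreatestSARE (P : Matrix (Fin n) (Fin n) ℝ) : Prop :=
  P.PosSemidef ∧ S.SARE P ∧
    ∀ P' : Matrix (Fin n) (Fin n) ℝ, P'.PosSemidef → S.SARE P' → (P - P').PosSemidef

end LQRData

end

/-! The proof is the Kleinman–Hewer argument for policy iteration, with the closed loop measured by
discounted stability. For a gain `L` let `dualMap L` be the adjoint of the second-moment map, so
that a cost kernel of `L` is a symmetric solution of the Lyapunov equation `G = lyap L G`.
Admissibility is an undiscounted property, and an improvement step may destroy it, because a
discounted optimum can tolerate growing states. `DiscountStable`, a Lyapunov inequality for `γ •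
dualMap L`, follows from admissibility, survives improvement (`DiscountStable.gainOf`), and yields a
comparison principle: if `γ • dualMap L X ≤ X` as quadratic forms, then `0 ≤ X`. Existence,
uniqueness and monotonicity of cost kernels all rest on this principle.

Completion of the square (`bellman_eq`) identifies the improved gain as the minimiser of the Bellman
expression. Hence the kernels decrease and converge, and their limit solves the Riccati equation. A
positive semidefinite solution lies below its Bellman update for every input, so it lies below every
kernel of the iteration; the limit is therefore the greatest such solution
(`IsKernelIteration.exists_limit`).

The value of the limit kernel is a lower bound for the cost of every admissible policy: the Bellman
inequality telescopes, and the discounted tail vanishes because second moments converge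
(`le_V_of_admissible`). For the upper bound, an iterate is used for `N` steps and the initial
admissible gain afterwards. This policy is admissible, and its excess cost vanishes as `N` grows
(`DiscountStable.Vstar_le`); then the iterates pass to the limit. The limit gain itself is not shown
to be admissible, so for it only an upper cost bound is proved, from partial sums.

The model-free equation reduces to this iteration. The trace term cancels the contribution of the
additive noise, and testing with deterministic pairs forces `H = kernelOf (compress L H)`. Then
`compress L H` solves the Lyapunov equation, which has only one symmetric solution
(`policyEvaluation_iff`, `DiscountStable.policyEvaluation_iff_eq`). -/

noncomputable section

/-- The quadratic form `xᵀ G x`. -/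
def qform {ι : Type*} [Fintype ι] (G : Matrix ι ι ℝ) (x : ι → ℝ) : ℝ := x ⬝ᵥ (G *ᵥ x)

/-! ### Quadratic forms: polarization, bounds and monotone limits. -/

section QuadraticForms

variable {ι κ : Type*} [Fintype ι] [Fintype κ]

lemma qform_add (G K : Matrix ι ι ℝ) (x : ι → ℝ) : qform (G + K) x = qform G x + qform K x := by
  simp [qform, Matrix.add_mulVec, dotProduct_add]

lemma qform_sub (G K : Matrix ι ι ℝ) (x : ι → ℝ) : qform (G - K) x = qform G x - qform K x := by
  simp [qform, Matrix.sub_mulVec, dotProduct_sub]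

lemma qform_smul (c : ℝ) (G : Matrix ι ι ℝ) (x : ι → ℝ) : qform (c • G) x = c * qform G x := by
  simp [qform, Matrix.smul_mulVec, dotProduct_smul]

lemma qform_zero (x : ι → ℝ) : qform (0 : Matrix ι ι ℝ) x = 0 := by simp [qform]

lemma qform_one [DecidableEq ι] (x : ι → ℝ) : qform (1 : Matrix ι ι ℝ) x = x ⬝ᵥ x := by
  simp [qform]

lemma qform_conj (F : Matrix κ ι ℝ) (G : Matrix κ κ ℝ) (x : ι → ℝ) :
    qform (Fᵀ * G * F) x = qform G (F *ᵥ x) := by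
  simp only [qform, Matrix.mul_assoc, ← Matrix.mulVec_mulVec]
  rw [Matrix.dotProduct_mulVec, Matrix.vecMul_transpose]

lemma qform_eq_sum (G : Matrix ι ι ℝ) (x : ι → ℝ) :
    qform G x = ∑ i, ∑ j, G i j * (x i * x j) := by
  simp only [qform, dotProduct, Matrix.mulVec, Finset.mul_sum]
  exact Finset.sum_congr rfl fun i _ => Finset.sum_congr rfl fun j _ => by ring

lemma qform_add_vec (G : Matrix ι ι ℝ) (x y : ι → ℝ) :
    qform G (x + y) = qform G x + (x ⬝ᵥ (G *ᵥ y) + y ⬝ᵥ (G *ᵥ x)) + qform G y := by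
  simp only [qform, Matrix.mulVec_add, dotProduct_add, add_dotProduct]
  ring

lemma qform_smul_vec (G : Matrix ι ι ℝ) (c : ℝ) (x : ι → ℝ) :
    qform G (c • x) = c ^ 2 * qform G x := by
  simp only [qform, Matrix.mulVec_smul, dotProduct_smul, smul_dotProduct, smul_eq_mul]
  ring

lemma qform_neg_vec (G : Matrix ι ι ℝ) (x : ι → ℝ) : qform G (-x) = qform G x := by
  simp [qform, Matrix.mulVec_neg]

/-- Polarization. -/
lemma entry_add_entry [DecidableEq ι] (G : Matrix ι ι ℝ) (i j : ι) :
    G i j + G j i = qform G (Pi.single i 1 + Pi.single j 1) - qform G (Pi.single i 1)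
      - qform G (Pi.single j 1) := by
  rw [qform_add_vec]
  simp
  ring

lemma eq_of_qform_eq {G K : Matrix ι ι ℝ} (hG : G.IsSymm) (hK : K.IsSymm)
    (h : ∀ x, qform G x = qform K x) : G = K := by
  classical
  ext i j
  have h1 := entry_add_entry G i j
  have h2 := entry_add_entry K i j
  rw [h, h, h, ← h2, hG.apply i j, hK.apply i j] at h1
  linarith

lemma posSemidef_iff_qform {G : Matrix ι ι ℝ} :
    G.PosSemidef ↔ G.IsSymm ∧ ∀ x, 0 ≤ qform G x := by
  rw [Matrix.posSemidef_iff_dotProduct_mulVec]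
  simp [Matrix.IsHermitian, Matrix.IsSymm, Matrix.conjTranspose_eq_transpose_of_trivial, qform]

lemma dotProduct_self_nonneg' (x : ι → ℝ) : 0 ≤ x ⬝ᵥ x :=
  Finset.sum_nonneg fun i _ => mul_self_nonneg (x i)

lemma sq_le_dotProduct_self (x : ι → ℝ) (i : ι) : x i * x i ≤ x ⬝ᵥ x :=
  Finset.single_le_sum (f := fun i => x i * x i) (fun j _ => mul_self_nonneg (x j))
    (Finset.mem_univ i)

lemma abs_qform_le (G : Matrix ι ι ℝ) (x : ι → ℝ) :
    |qform G x| ≤ (∑ i, ∑ j, |G i j|) * (x ⬝ᵥ x) := by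
  rw [qform_eq_sum, Finset.sum_mul]
  refine (Finset.abs_sum_le_sum_abs _ _).trans (Finset.sum_le_sum fun i _ => ?_)
  rw [Finset.sum_mul]
  refine (Finset.abs_sum_le_sum_abs _ _).trans (Finset.sum_le_sum fun j _ => ?_)
  rw [abs_mul]
  refine mul_le_mul_of_nonneg_left ?_ (abs_nonneg _)
  have h1 := sq_le_dotProduct_self x i
  have h2 := sq_le_dotProduct_self x j
  rw [abs_le]
  constructor <;> nlinarith [sq_nonneg (x i + x j), sq_nonneg (x i - x j)]

lemma exists_abs_qform_le (G : Matrix ι ι ℝ) : ∃ b > 0, ∀ x, |qform G x| ≤ b * (x ⬝ᵥ x) := by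
  refine ⟨(∑ i, ∑ j, |G i j|) + 1, by positivity, fun x => ?_⟩
  nlinarith [abs_qform_le G x, dotProduct_self_nonneg' x]

/-- If `b` bounds the form of `G⁻¹`, nonnegativity of the form of `G` at `x - b⁻¹ G⁻¹ x` gives the
lower bound `2b⁻¹ - b⁻² b = b⁻¹`. No spectral theory is needed. -/
lemma Matrix.PosDef.exists_le_qform [DecidableEq ι] {G : Matrix ι ι ℝ} (hG : G.PosDef) :
    ∃ r > 0, ∀ x, r * (x ⬝ᵥ x) ≤ qform G x := by
  obtain ⟨b, hb, hle⟩ := exists_abs_qform_le G⁻¹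
  refine ⟨b⁻¹, by positivity, fun x => ?_⟩
  have hdet : IsUnit G.det := (Matrix.isUnit_iff_isUnit_det G).1 hG.isUnit
  have hpos : ∀ y, 0 ≤ qform G y := (posSemidef_iff_qform.1 hG.posSemidef).2
  -- `0 ≤ (x - b⁻¹ G⁻¹ x)ᵀ G (x - b⁻¹ G⁻¹ x)`
  have h := hpos (x + (-b⁻¹) • (G⁻¹ *ᵥ x))
  have hsym : G.IsSymm := (posSemidef_iff_qform.1 hG.posSemidef).1
  have e1 : G *ᵥ (G⁻¹ *ᵥ x) = x := by
    rw [Matrix.mulVec_mulVec, Matrix.mul_nonsing_inv _ hdet, Matrix.one_mulVec]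
  have e2 : (G⁻¹ *ᵥ x) ⬝ᵥ (G *ᵥ x) = x ⬝ᵥ x := by
    have := Matrix.dotProduct_transpose_mulVec G (G⁻¹ *ᵥ x) x
    rwa [hsym.eq, e1] at this
  have e3 : qform G (G⁻¹ *ᵥ x) = qform G⁻¹ x := by
    rw [qform, e1, dotProduct_comm, qform]
  rw [qform_add_vec, qform_smul_vec, e3, Matrix.mulVec_smul, e1, smul_dotProduct, e2,
    dotProduct_smul, smul_eq_mul] at h
  have h4 := (le_abs_self _).trans (hle x)
  have h5 : b⁻¹ ^ 2 * qform G⁻¹ x ≤ b⁻¹ ^ 2 * (b * (x ⬝ᵥ x)) := by gcongr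
  have h6 : b⁻¹ ^ 2 * (b * (x ⬝ᵥ x)) = b⁻¹ * (x ⬝ᵥ x) := by field_simp
  nlinarith

lemma posDef_of_le_qform {G : Matrix ι ι ℝ} (hG : G.IsSymm) {r : ℝ} (hr : 0 < r)
    (h : ∀ x, r * (x ⬝ᵥ x) ≤ qform G x) : G.PosDef := by
  refine Matrix.PosDef.of_dotProduct_mulVec_pos
    (by rw [Matrix.IsHermitian, Matrix.conjTranspose_eq_transpose_of_trivial]; exact hG) ?_
  intro x hx
  have h0 : 0 < x ⬝ᵥ x :=
    lt_of_le_of_ne (dotProduct_self_nonneg' x) fun h0 => hx (dotProduct_self_eq_zero.1 h0.symm)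
  exact (mul_pos hr h0).trans_le (h x)

/-- Young's inequality: expand the nonnegative form at `ε p - q` and divide by `ε`. It serves to
perturb a Lyapunov inequality when the gain changes. -/
lemma qform_add_vec_le {G : Matrix ι ι ℝ} (hG : ∀ x, 0 ≤ qform G x) {ε : ℝ} (hε : 0 < ε)
    (p q : ι → ℝ) :
    qform G (p + q) ≤ (1 + ε) * qform G p + (1 + ε⁻¹) * qform G q := by
  have h := hG (ε • p + (-1 : ℝ) • q)
  rw [qform_add_vec, qform_smul_vec, qform_smul_vec, Matrix.mulVec_smul, Matrix.mulVec_smul,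
    smul_dotProduct, dotProduct_smul, dotProduct_smul, smul_dotProduct] at h
  simp only [smul_eq_mul] at h
  rw [qform_add_vec]
  have h2 : 0 ≤ ε⁻¹ * (ε ^ 2 * qform G p + (ε * (-1 * p ⬝ᵥ G *ᵥ q) + ε * (-1 * q ⬝ᵥ G *ᵥ p))
      + (-1) ^ 2 * qform G q) := mul_nonneg (by positivity) h
  have h3 : ε⁻¹ * (ε ^ 2 * qform G p + (ε * (-1 * p ⬝ᵥ G *ᵥ q) + ε * (-1 * q ⬝ᵥ G *ᵥ p))
      + (-1) ^ 2 * qform G q)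
      = ε * qform G p - (p ⬝ᵥ G *ᵥ q + q ⬝ᵥ G *ᵥ p) + ε⁻¹ * qform G q := by
    field_simp
    ring
  linarith

/-- Symmetric matrices whose quadratic forms are antitone and bounded below converge. -/
lemma tendsto_of_qform_antitone {G : ℕ → Matrix ι ι ℝ} (hG : ∀ k, (G k).IsSymm)
    (hpos : ∀ k x, 0 ≤ qform (G k) x) (hanti : ∀ k x, qform (G (k + 1)) x ≤ qform (G k) x) :
    ∃ G', Tendsto G atTop (𝓝 G') := by
  classical
  have hlim : ∀ x, ∃ l, Tendsto (fun k => qform (G k) x) atTop (𝓝 l) := fun x =>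
    ⟨_, tendsto_atTop_ciInf (antitone_nat_of_succ_le fun k => hanti k x)
      ⟨0, by rintro _ ⟨k, rfl⟩; exact hpos k x⟩⟩
  choose l hl using hlim
  -- Polarization recovers each entry from three limiting values of the form.
  refine ⟨Matrix.of fun i j => (l (Pi.single i 1 + Pi.single j 1) - l (Pi.single i 1)
    - l (Pi.single j 1)) / 2, ?_⟩
  refine tendsto_pi_nhds.2 fun i => tendsto_pi_nhds.2 fun j => ?_
  have he : (fun k => G k i j) = fun k => (qform (G k) (Pi.single i 1 + Pi.single j 1)
      - qform (G k) (Pi.single i 1) - qform (G k) (Pi.single j 1)) / 2 := by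
    funext k
    rw [← entry_add_entry, (hG k).apply i j]
    ring
  rw [he]
  exact (((hl _).sub (hl _)).sub (hl _)).div_const 2

@[fun_prop]
lemma continuous_qform (x : ι → ℝ) : Continuous fun G : Matrix ι ι ℝ => qform G x := by
  unfold qform
  fun_prop

end QuadraticForms

namespace LQRData

/-! ### Closed-loop operators, the comparison principle and the Lyapunov equation. -/

section Riccati

variable {n m : ℕ} (S : LQRData n m)

/-- The closed-loop drift matrix of `u = L x`. -/
def Acl (L : Matrix (Fin m) (Fin n) ℝ) : Matrix (Fin n) (Fin n) ℝ := S.A + S.B * L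

/-- The closed-loop diffusion matrix of `u = L x`. -/
def Ccl (L : Matrix (Fin m) (Fin n) ℝ) : Matrix (Fin n) (Fin n) ℝ := S.C + S.D * L

/-- The adjoint of the second-moment map of the closed loop of `u = L x`. -/
def dualMap (L : Matrix (Fin m) (Fin n) ℝ) (G : Matrix (Fin n) (Fin n) ℝ) :
    Matrix (Fin n) (Fin n) ℝ :=
  (S.Acl L)ᵀ * G * S.Acl L + (S.Ccl L)ᵀ * G * S.Ccl L

/-- The right-hand side of the discounted Lyapunov equation of `u = L x`. -/
def lyap (L : Matrix (Fin m) (Fin n) ℝ) (G : Matrix (Fin n) (Fin n) ℝ) :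
    Matrix (Fin n) (Fin n) ℝ :=
  S.Q + Lᵀ * S.R * L + S.γ • S.dualMap L G

/-- One-step cost plus discounted quadratic cost-to-go, up to the additive noise. -/
def bellman (G : Matrix (Fin n) (Fin n) ℝ) (x : Fin n → ℝ) (u : Fin m → ℝ) : ℝ :=
  S.cost x u + S.γ * (qform G (S.A *ᵥ x + S.B *ᵥ u) + qform G (S.C *ᵥ x + S.D *ᵥ u))

/-- Discounted mean-square stability of `u = L x`, by a Lyapunov matrix. -/
def DiscountStable (L : Matrix (Fin m) (Fin n) ℝ) : Prop :=
  ∃ Y : Matrix (Fin n) (Fin n) ℝ, (∀ x, 0 ≤ qform Y x) ∧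
    ∀ x, x ⬝ᵥ x + S.γ * qform (S.dualMap L Y) x ≤ qform Y x

/-- The kernel of `x ↦ [x; L x]ᵀ H [x; L x]`. -/
def compress (L : Matrix (Fin m) (Fin n) ℝ) (H : Matrix (Fin n ⊕ Fin m) (Fin n ⊕ Fin m) ℝ) :
    Matrix (Fin n) (Fin n) ℝ :=
  (Matrix.fromRows (1 : Matrix (Fin n) (Fin n) ℝ) L)ᵀ * H *
    Matrix.fromRows (1 : Matrix (Fin n) (Fin n) ℝ) L

variable {S} in
lemma Acl_mulVec (L : Matrix (Fin m) (Fin n) ℝ) (x : Fin n → ℝ) :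
    S.Acl L *ᵥ x = S.A *ᵥ x + S.B *ᵥ (L *ᵥ x) := by
  simp [Acl, Matrix.add_mulVec]

variable {S} in
lemma Ccl_mulVec (L : Matrix (Fin m) (Fin n) ℝ) (x : Fin n → ℝ) :
    S.Ccl L *ᵥ x = S.C *ᵥ x + S.D *ᵥ (L *ᵥ x) := by
  simp [Ccl, Matrix.add_mulVec]

lemma qform_dualMap (L : Matrix (Fin m) (Fin n) ℝ) (G : Matrix (Fin n) (Fin n) ℝ)
    (x : Fin n → ℝ) :
    qform (S.dualMap L G) x = qform G (S.Acl L *ᵥ x) + qform G (S.Ccl L *ᵥ x) := by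
  rw [dualMap, qform_add, qform_conj, qform_conj]

lemma dualMap_add (L : Matrix (Fin m) (Fin n) ℝ) (G K : Matrix (Fin n) (Fin n) ℝ) :
    S.dualMap L (G + K) = S.dualMap L G + S.dualMap L K := by
  simp only [dualMap, mul_add, add_mul]
  abel

lemma dualMap_smul (L : Matrix (Fin m) (Fin n) ℝ) (c : ℝ) (G : Matrix (Fin n) (Fin n) ℝ) :
    S.dualMap L (c • G) = c • S.dualMap L G := by
  simp [dualMap, smul_add]

lemma dualMap_transpose (L : Matrix (Fin m) (Fin n) ℝ) (G : Matrix (Fin n) (Fin n) ℝ) :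
    (S.dualMap L G)ᵀ = S.dualMap L Gᵀ := by
  simp [dualMap, Matrix.mul_assoc]

lemma cost_eq (x : Fin n → ℝ) (u : Fin m → ℝ) : S.cost x u = qform S.Q x + qform S.R u := rfl

lemma qform_lyap (L : Matrix (Fin m) (Fin n) ℝ) (G : Matrix (Fin n) (Fin n) ℝ)
    (x : Fin n → ℝ) : qform (S.lyap L G) x = S.bellman G x (L *ᵥ x) := by
  rw [lyap, qform_add, qform_add, qform_smul, qform_conj, qform_dualMap, bellman, cost_eq,
    Acl_mulVec, Ccl_mulVec]

lemma quad_fromBlocks (F : Matrix (Fin n) (Fin n) ℝ) (G : Matrix (Fin n) (Fin m) ℝ)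
    (K : Matrix (Fin m) (Fin n) ℝ) (M : Matrix (Fin m) (Fin m) ℝ)
    (x : Fin n → ℝ) (u : Fin m → ℝ) :
    quad (Matrix.fromBlocks F G K M) x u
      = qform F x + x ⬝ᵥ (G *ᵥ u) + u ⬝ᵥ (K *ᵥ x) + qform M u := by
  rw [quad, Matrix.fromBlocks_mulVec, sumElim_dotProduct_sumElim]
  simp only [Sum.elim_comp_inl, Sum.elim_comp_inr, dotProduct_add, qform]
  ring

lemma dotProduct_transpose_mul_mul_mulVec {ι κ : Type*} [Fintype ι] [Fintype κ]
    (F : Matrix (Fin n) ι ℝ) (G : Matrix (Fin n) (Fin n) ℝ) (K : Matrix (Fin n) κ ℝ)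
    (x : ι → ℝ) (u : κ → ℝ) :
    x ⬝ᵥ ((Fᵀ * G * K) *ᵥ u) = (F *ᵥ x) ⬝ᵥ (G *ᵥ (K *ᵥ u)) := by
  rw [Matrix.mul_assoc, ← Matrix.mulVec_mulVec, ← Matrix.mulVec_mulVec,
    Matrix.dotProduct_mulVec, Matrix.vecMul_transpose]

lemma quad_kernelOf (G : Matrix (Fin n) (Fin n) ℝ) (x : Fin n → ℝ) (u : Fin m → ℝ) :
    quad (S.kernelOf G) x u = S.bellman G x u := by
  rw [kernelOf, quad_fromBlocks, Hxx, Hxu, Hux, Huu, bellman, cost_eq]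
  simp only [qform_add, qform_smul, qform_conj, Matrix.add_mulVec, Matrix.smul_mulVec,
    dotProduct_add, dotProduct_smul, dotProduct_transpose_mul_mul_mulVec, qform_add_vec,
    smul_eq_mul]
  ring

lemma qform_compress (L : Matrix (Fin m) (Fin n) ℝ)
    (H : Matrix (Fin n ⊕ Fin m) (Fin n ⊕ Fin m) ℝ) (x : Fin n → ℝ) :
    qform (compress L H) x = quad H x (L *ᵥ x) := by
  rw [compress, qform_conj, Matrix.fromRows_mulVec, Matrix.one_mulVec]
  rfl

lemma compress_isSymm (L : Matrix (Fin m) (Fin n) ℝ)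
    {H : Matrix (Fin n ⊕ Fin m) (Fin n ⊕ Fin m) ℝ} (hH : H.IsSymm) : (compress L H).IsSymm := by
  simp [compress, Matrix.IsSymm, hH.eq, Matrix.mul_assoc]

lemma noiseTrace_eq (L : Matrix (Fin m) (Fin n) ℝ)
    (H : Matrix (Fin n ⊕ Fin m) (Fin n ⊕ Fin m) ℝ) :
    S.noiseTrace H L = (compress L H * S.W).trace := by
  rw [noiseTrace, compress, ← Matrix.mul_assoc, ← Matrix.mul_assoc, Matrix.trace_mul_comm]
  simp only [Matrix.mul_assoc]

/-- The equation `P = lyap L P` propagates nonnegativity under discounted stability. -/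
lemma DiscountStable.comparison {L : Matrix (Fin m) (Fin n) ℝ} (hL : S.DiscountStable L)
    (hγ : 0 ≤ S.γ) {X : Matrix (Fin n) (Fin n) ℝ}
    (hX : ∀ x, S.γ * qform (S.dualMap L X) x ≤ qform X x) (x : Fin n → ℝ) : 0 ≤ qform X x := by
  obtain ⟨Y, hY, hYL⟩ := hL
  obtain ⟨b, hb, hbX⟩ := exists_abs_qform_le X
  obtain ⟨s, hs, hsY⟩ := exists_abs_qform_le Y
  have hY1 : ∀ x, x ⬝ᵥ x ≤ qform Y x := fun x => by
    have h1 : 0 ≤ S.γ * qform (S.dualMap L Y) x :=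
      mul_nonneg hγ (by rw [qform_dualMap]; exact add_nonneg (hY _) (hY _))
    linarith [hYL x]
  -- As `Y ≤ s` times the squared norm, the Lyapunov inequality gives the contraction `γ • dualMap L
  -- Y ≤ ρ Y`. Taking `s + 1` instead of `s` keeps `ρ` in `(0, 1)` even when `s` is small.
  set ρ : ℝ := 1 - (s + 1)⁻¹ with hρ
  have hs1 : (s + 1)⁻¹ < 1 := inv_lt_one_of_one_lt₀ (by linarith)
  have hs0 : 0 < (s + 1)⁻¹ := by positivity
  -- A lower bound `X ≥ -t Y` improves itself: `X ≥ γ • dualMap L X ≥ -t γ • dualMap L Y ≥ -t ρ Y`.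
  -- It starts with `t = b`, since `Y` dominates the squared norm.
  have key : ∀ k : ℕ, ∀ x, 0 ≤ qform X x + b * ρ ^ k * qform Y x := by
    intro k
    induction k with
    | zero =>
      intro x
      have h1 := (abs_le.1 (hbX x)).1
      have h2 := mul_le_mul_of_nonneg_left (hY1 x) hb.le
      simp only [pow_zero, mul_one]
      linarith
    | succ k ih =>
      intro x
      set t := b * ρ ^ k with ht
      have ht0 : 0 ≤ t := mul_nonneg hb.le (pow_nonneg (by linarith) _)
      have h1 := mul_nonneg hγ (add_nonneg (ih (S.Acl L *ᵥ x)) (ih (S.Ccl L *ᵥ x)))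
      have h2 := hX x
      have h3 := mul_le_mul_of_nonneg_left (hYL x) ht0
      rw [qform_dualMap] at h2 h3
      have h4 : (s + 1)⁻¹ * qform Y x ≤ x ⬝ᵥ x := by
        rw [inv_mul_le_iff₀ (by positivity)]
        have := (le_abs_self _).trans (hsY x)
        nlinarith [dotProduct_self_nonneg' x]
      have h5 := mul_le_mul_of_nonneg_left h4 ht0
      have h6 : b * ρ ^ (k + 1) = t * ρ := by rw [ht, pow_succ]; ring
      rw [h6, hρ]
      nlinarith
  have hlim : Tendsto (fun k : ℕ => qform X x + b * ρ ^ k * qform Y x) atTop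
      (𝓝 (qform X x + b * 0 * qform Y x)) :=
    (((tendsto_pow_atTop_nhds_zero_of_lt_one (by linarith) (by linarith)).const_mul b).mul_const
      _).const_add _
  have := ge_of_tendsto' hlim fun k => key k x
  simpa using this

lemma lyap_isSymm (hQ : S.Q.IsSymm) (hR : S.R.IsSymm) (L : Matrix (Fin m) (Fin n) ℝ)
    {G : Matrix (Fin n) (Fin n) ℝ} (hG : G.IsSymm) : (S.lyap L G).IsSymm := by
  rw [Matrix.IsSymm, lyap, Matrix.transpose_add, Matrix.transpose_add, Matrix.transpose_smul,
    dualMap_transpose, hG.eq, hQ.eq]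
  simp [hR.eq, Matrix.mul_assoc]

/-- The cost terms cancel in a difference of two solutions, so comparison applies to the difference
with either sign. -/
lemma DiscountStable.eq_of_lyap {L : Matrix (Fin m) (Fin n) ℝ} (hL : S.DiscountStable L)
    (hγ : 0 ≤ S.γ) {X Y : Matrix (Fin n) (Fin n) ℝ} (hXs : X.IsSymm) (hYs : Y.IsSymm)
    (hX : X = S.lyap L X) (hY : Y = S.lyap L Y) : X = Y := by
  refine eq_of_qform_eq hXs hYs fun x => ?_
  have hX' : ∀ x, qform X x = S.bellman X x (L *ᵥ x) := fun x => by
    rw [← qform_lyap, ← hX]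
  have hY' : ∀ x, qform Y x = S.bellman Y x (L *ᵥ x) := fun x => by
    rw [← qform_lyap, ← hY]
  have h1 := hL.comparison S hγ (X := X - Y) (fun x => by
    rw [qform_dualMap, qform_sub, qform_sub, qform_sub, hX' x, hY' x, bellman, bellman,
      Acl_mulVec, Ccl_mulVec]
    linarith) x
  have h2 := hL.comparison S hγ (X := Y - X) (fun x => by
    rw [qform_dualMap, qform_sub, qform_sub, qform_sub, hX' x, hY' x, bellman, bellman,
      Acl_mulVec, Ccl_mulVec]
    linarith) x
  rw [qform_sub] at h1 h2
  linarith

/-- Existence follows from uniqueness: an injective linear map on a finite-dimensional space is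
surjective. Comparison controls only quadratic forms, so the kernel must first be seen to consist of
symmetric matrices. -/
lemma DiscountStable.exists_lyap {L : Matrix (Fin m) (Fin n) ℝ} (hL : S.DiscountStable L)
    (hγ : 0 ≤ S.γ) (hQ : S.Q.IsSymm) (hR : S.R.IsSymm) :
    ∃ X : Matrix (Fin n) (Fin n) ℝ, X.IsSymm ∧ X = S.lyap L X := by
  -- solve the equation with the symmetrized unknown, which makes the operator injective
  let T : Matrix (Fin n) (Fin n) ℝ →ₗ[ℝ] Matrix (Fin n) (Fin n) ℝ :=
    { toFun := fun X => X - S.γ • S.dualMap L ((1 / 2 : ℝ) • (X + Xᵀ))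
      map_add' := fun X Y => by
        simp only [Matrix.transpose_add, smul_add, dualMap_add]
        abel
      map_smul' := fun c X => by
        simp only [Matrix.transpose_smul, dualMap_smul, RingHom.id_apply, smul_sub, ← smul_add]
        simp only [smul_smul]
        congr 2
        ring }
  have hT : ∀ X, T X = X - S.γ • S.dualMap L ((1 / 2 : ℝ) • (X + Xᵀ)) := fun X => rfl
  have hsymm : ∀ X, (T X).IsSymm → X.IsSymm := by
    intro X h
    have h1 : X = T X + S.γ • S.dualMap L ((1 / 2 : ℝ) • (X + Xᵀ)) := by rw [hT]; abel
    rw [Matrix.IsSymm, h1, Matrix.transpose_add, h.eq, Matrix.transpose_smul, dualMap_transpose,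
      Matrix.transpose_smul, Matrix.transpose_add, Matrix.transpose_transpose, add_comm Xᵀ X]
  have hhalf : ∀ X : Matrix (Fin n) (Fin n) ℝ, X.IsSymm → (1 / 2 : ℝ) • (X + Xᵀ) = X := by
    intro X h
    rw [h.eq, ← two_smul ℝ X, smul_smul]
    norm_num
  have hinj : Function.Injective T := by
    refine (injective_iff_map_eq_zero T).2 fun X hX => ?_
    have hs : X.IsSymm := hsymm X (by rw [hX]; exact Matrix.isSymm_zero)
    rw [hT, hhalf X hs, sub_eq_zero] at hX
    have hq : ∀ x, qform X x = S.γ * qform (S.dualMap L X) x := fun x => by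
      rw [← qform_smul, ← hX]
    refine eq_of_qform_eq hs Matrix.isSymm_zero fun x => ?_
    have h1 := hL.comparison S hγ (X := X) (fun x => (hq x).ge) x
    have h2 := hL.comparison S hγ (X := (-1 : ℝ) • X) (fun x => by
      rw [dualMap_smul, qform_smul, qform_smul, hq x]
      linarith) x
    rw [qform_smul] at h2
    rw [qform_zero]
    linarith
  obtain ⟨X, hX⟩ := (LinearMap.injective_iff_surjective.1 hinj) (S.Q + Lᵀ * S.R * L)
  have hs : X.IsSymm := hsymm X (by
    rw [hX]
    simp [Matrix.IsSymm, hQ.eq, hR.eq, Matrix.mul_assoc])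
  refine ⟨X, hs, ?_⟩
  rw [hT, hhalf X hs] at hX
  rw [lyap, ← hX]
  abel

end Riccati

/-! ### Policy improvement, monotone convergence and the Riccati equation. -/

section PolicyIteration

variable {n m : ℕ} (S : LQRData n m)

lemma Hux_transpose {G : Matrix (Fin n) (Fin n) ℝ} (hG : G.IsSymm) : (S.Hux G)ᵀ = S.Hxu G := by
  simp [Hux, Hxu, hG.eq, Matrix.mul_assoc]

lemma Huu_isSymm (hR : S.R.IsSymm) {G : Matrix (Fin n) (Fin n) ℝ} (hG : G.IsSymm) :
    (S.Huu G).IsSymm := by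
  simp [Matrix.IsSymm, Huu, hG.eq, hR.eq, Matrix.mul_assoc]

lemma Hxx_isSymm (hQ : S.Q.IsSymm) {G : Matrix (Fin n) (Fin n) ℝ} (hG : G.IsSymm) :
    (S.Hxx G).IsSymm := by
  simp [Matrix.IsSymm, Hxx, hG.eq, hQ.eq, Matrix.mul_assoc]

lemma kernelOf_isSymm (hQ : S.Q.IsSymm) (hR : S.R.IsSymm) {G : Matrix (Fin n) (Fin n) ℝ}
    (hG : G.IsSymm) : (S.kernelOf G).IsSymm :=
  Matrix.IsSymm.fromBlocks (S.Hxx_isSymm hQ hG) (by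
    rw [← S.Hux_transpose hG, Matrix.transpose_transpose]) (S.Huu_isSymm hR hG)

lemma qform_R_le_Huu (hγ : 0 ≤ S.γ) {G : Matrix (Fin n) (Fin n) ℝ} (hG : ∀ x, 0 ≤ qform G x)
    (u : Fin m → ℝ) : qform S.R u ≤ qform (S.Huu G) u := by
  rw [Huu, qform_add, qform_add, qform_smul, qform_smul, qform_conj, qform_conj]
  have h1 := mul_nonneg hγ (hG (S.B *ᵥ u))
  have h2 := mul_nonneg hγ (hG (S.D *ᵥ u))
  linarith

lemma Huu_posDef (hR : S.R.PosDef) (hγ : 0 ≤ S.γ) {G : Matrix (Fin n) (Fin n) ℝ}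
    (hG : G.PosSemidef) : (S.Huu G).PosDef := by
  obtain ⟨hs, hpos⟩ := posSemidef_iff_qform.1 hG
  obtain ⟨r, hr, hle⟩ := hR.exists_le_qform
  exact posDef_of_le_qform (S.Huu_isSymm (posSemidef_iff_qform.1 hR.posSemidef).1 hs) hr
    fun u => (hle u).trans (S.qform_R_le_Huu hγ hpos u)

/-- Completion of the square. -/
lemma bellman_eq (hR : S.R.PosDef) (hγ : 0 ≤ S.γ) {G : Matrix (Fin n) (Fin n) ℝ}
    (hG : G.PosSemidef) (x : Fin n → ℝ) (u : Fin m → ℝ) :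
    S.bellman G x u = qform (S.Hxx G - S.Hxu G * (S.Huu G)⁻¹ * S.Hux G) x
      + qform (S.Huu G) (u - S.gainOf G *ᵥ x) := by
  have hs := (posSemidef_iff_qform.1 hG).1
  have hU := S.Huu_posDef hR hγ hG
  have hUs := (posSemidef_iff_qform.1 hU.posSemidef).1
  have hdet : IsUnit (S.Huu G).det := (Matrix.isUnit_iff_isUnit_det _).1 hU.isUnit
  rw [← quad_kernelOf, kernelOf, quad_fromBlocks]
  set g := (S.Huu G)⁻¹ *ᵥ (S.Hux G *ᵥ x) with hg
  have hgain : u - S.gainOf G *ᵥ x = u + g := by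
    rw [gainOf, Matrix.neg_mulVec, ← Matrix.mulVec_mulVec, sub_neg_eq_add]
  have hUg : S.Huu G *ᵥ g = S.Hux G *ᵥ x := by
    rw [hg, Matrix.mulVec_mulVec, Matrix.mul_nonsing_inv _ hdet, Matrix.one_mulVec]
  have hxu : ∀ v, x ⬝ᵥ (S.Hxu G *ᵥ v) = v ⬝ᵥ (S.Hux G *ᵥ x) := fun v => by
    rw [← S.Hux_transpose hs, Matrix.dotProduct_transpose_mulVec]
  have h2 : qform (S.Hxu G * (S.Huu G)⁻¹ * S.Hux G) x = g ⬝ᵥ (S.Hux G *ᵥ x) := by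
    rw [qform, ← Matrix.mulVec_mulVec, ← Matrix.mulVec_mulVec, hxu]
  have h3 : g ⬝ᵥ (S.Huu G *ᵥ u) = u ⬝ᵥ (S.Hux G *ᵥ x) := by
    have := Matrix.dotProduct_transpose_mulVec (S.Huu G) g u
    rwa [hUs.eq, hUg] at this
  rw [hgain, qform_sub, h2, qform_add_vec, hUg, h3, hxu]
  have h4 : qform (S.Huu G) g = g ⬝ᵥ (S.Hux G *ᵥ x) := by rw [qform, hUg]
  rw [h4]
  ring

lemma bellman_gainOf_add (hR : S.R.PosDef) (hγ : 0 ≤ S.γ) {G : Matrix (Fin n) (Fin n) ℝ}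
    (hG : G.PosSemidef) (x : Fin n → ℝ) (u : Fin m → ℝ) :
    S.bellman G x u = S.bellman G x (S.gainOf G *ᵥ x)
      + qform (S.Huu G) (u - S.gainOf G *ᵥ x) := by
  rw [S.bellman_eq hR hγ hG x u, S.bellman_eq hR hγ hG x (S.gainOf G *ᵥ x), sub_self]
  simp [qform]

lemma bellman_gainOf_le (hR : S.R.PosDef) (hγ : 0 ≤ S.γ) {G : Matrix (Fin n) (Fin n) ℝ}
    (hG : G.PosSemidef) (x : Fin n → ℝ) (u : Fin m → ℝ) :
    S.bellman G x (S.gainOf G *ᵥ x) ≤ S.bellman G x u := by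
  rw [S.bellman_gainOf_add hR hγ hG x u]
  exact le_add_of_nonneg_right ((posSemidef_iff_qform.1 (S.Huu_posDef hR hγ hG).posSemidef).2 _)

/-- At the minimising input the completed square vanishes. The Riccati equation thus says that `G`
is a cost kernel of its own greedy gain. -/
lemma lyap_gainOf (hQ : S.Q.PosSemidef) (hR : S.R.PosDef) (hγ : 0 ≤ S.γ)
    {G : Matrix (Fin n) (Fin n) ℝ} (hG : G.PosSemidef) :
    S.lyap (S.gainOf G) G = S.Hxx G - S.Hxu G * (S.Huu G)⁻¹ * S.Hux G := by
  have hs := (posSemidef_iff_qform.1 hG).1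
  have hQs := (posSemidef_iff_qform.1 hQ).1
  have hRs := (posSemidef_iff_qform.1 hR.posSemidef).1
  refine eq_of_qform_eq (S.lyap_isSymm hQs hRs _ hs) ?_ fun x => ?_
  · rw [Matrix.IsSymm, Matrix.transpose_sub, (S.Hxx_isSymm hQs hs).eq, Matrix.transpose_mul,
      Matrix.transpose_mul, S.Hux_transpose hs, ← S.Hux_transpose hs, Matrix.transpose_transpose,
      Matrix.transpose_nonsing_inv, (S.Huu_isSymm hRs hs).eq, Matrix.mul_assoc]
  · rw [qform_lyap, S.bellman_eq hR hγ hG, sub_self]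
    simp [qform]

lemma sare_iff (hQ : S.Q.PosSemidef) (hR : S.R.PosDef) (hγ : 0 ≤ S.γ)
    {G : Matrix (Fin n) (Fin n) ℝ} (hG : G.PosSemidef) :
    S.SARE G ↔ G = S.lyap (S.gainOf G) G := by
  rw [SARE, S.lyap_gainOf hQ hR hγ hG]

/-- `G` is the cost kernel of the gain `L`. -/
def IsCostKernel (L : Matrix (Fin m) (Fin n) ℝ) (G : Matrix (Fin n) (Fin n) ℝ) : Prop :=
  G.IsSymm ∧ G = S.lyap L G

variable {S}

lemma IsCostKernel.qform_eq {L : Matrix (Fin m) (Fin n) ℝ} {G : Matrix (Fin n) (Fin n) ℝ}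
    (h : S.IsCostKernel L G) (x : Fin n → ℝ) : qform G x = S.bellman G x (L *ᵥ x) := by
  rw [← qform_lyap, ← h.2]

lemma cost_nonneg (hQ : S.Q.PosSemidef) (hR : S.R.PosDef) (x : Fin n → ℝ) (u : Fin m → ℝ) :
    0 ≤ S.cost x u :=
  add_nonneg ((posSemidef_iff_qform.1 hQ).2 x) ((posSemidef_iff_qform.1 hR.posSemidef).2 u)

lemma IsCostKernel.posSemidef {L : Matrix (Fin m) (Fin n) ℝ} {G : Matrix (Fin n) (Fin n) ℝ}
    (h : S.IsCostKernel L G) (hQ : S.Q.PosSemidef) (hR : S.R.PosDef) (hγ : 0 ≤ S.γ)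
    (hL : S.DiscountStable L) : G.PosSemidef := by
  refine posSemidef_iff_qform.2 ⟨h.1, hL.comparison S hγ fun x => ?_⟩
  rw [h.qform_eq, bellman, qform_dualMap, Acl_mulVec, Ccl_mulVec]
  linarith [cost_nonneg hQ hR x (L *ᵥ x)]

/-- The policy improvement step preserves discounted stability. -/
lemma DiscountStable.gainOf {L : Matrix (Fin m) (Fin n) ℝ} {G : Matrix (Fin n) (Fin n) ℝ}
    (hL : S.DiscountStable L) (h : S.IsCostKernel L G) (hQ : S.Q.PosSemidef) (hR : S.R.PosDef)
    (hγ : 0 ≤ S.γ) (hγ1 : S.γ < 1) : S.DiscountStable (S.gainOf G) := by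
  have hG := h.posSemidef hQ hR hγ hL
  have hGpos := (posSemidef_iff_qform.1 hG).2
  obtain ⟨Y, hY, hYL⟩ := hL
  obtain ⟨s, hs, hsY⟩ := exists_abs_qform_le Y
  obtain ⟨b₁, hb₁, hB⟩ := exists_abs_qform_le (S.Bᵀ * Y * S.B)
  obtain ⟨b₂, hb₂, hD⟩ := exists_abs_qform_le (S.Dᵀ * Y * S.D)
  obtain ⟨r, hr, hRr⟩ := hR.exists_le_qform
  -- With this `ε` the Young loss `ε Y` is at most half the squared norm. The constant `b` below
  -- lets the decrease of `b G`, at least `b r` times the squared norm of the gain change `e`, pay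
  -- for the terms in `B e` and `D e`.
  set ε : ℝ := (2 * s)⁻¹ with hε
  have hε0 : 0 < ε := by positivity
  set b : ℝ := (1 + ε⁻¹) * (b₁ + b₂) / r with hb
  have hb0 : 0 < b := by positivity
  have hbr : b * r = (1 + ε⁻¹) * (b₁ + b₂) := by rw [hb]; field_simp
  -- `Y + b G` decreases by at least half the squared norm along the new closed loop; the factor `2`
  -- restores the normalisation.
  refine ⟨(2 : ℝ) • (Y + b • G), fun x => ?_, fun x => ?_⟩
  · rw [qform_smul, qform_add, qform_smul]
    have := mul_nonneg hb0.le (hGpos x)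
    linarith [hY x]
  · set K := S.gainOf G with hK
    set e := K *ᵥ x - L *ᵥ x with he
    have hA : S.Acl K *ᵥ x = S.Acl L *ᵥ x + S.B *ᵥ e := by
      rw [Acl_mulVec, Acl_mulVec, he, Matrix.mulVec_sub]; abel
    have hC : S.Ccl K *ᵥ x = S.Ccl L *ᵥ x + S.D *ᵥ e := by
      rw [Ccl_mulVec, Ccl_mulVec, he, Matrix.mulVec_sub]; abel
    have hYA := qform_add_vec_le hY hε0 (S.Acl L *ᵥ x) (S.B *ᵥ e)
    have hYC := qform_add_vec_le hY hε0 (S.Ccl L *ᵥ x) (S.D *ᵥ e)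
    rw [← hA] at hYA
    rw [← hC] at hYC
    have hB' := (le_abs_self _).trans (hB e)
    have hD' := (le_abs_self _).trans (hD e)
    rw [qform_conj] at hB' hD'
    have hYx := hYL x
    rw [qform_dualMap] at hYx
    have hsx := (le_abs_self _).trans (hsY x)
    have hee : 0 ≤ e ⬝ᵥ e := dotProduct_self_nonneg' e
    -- The old input `L x` attains the value `G` and exceeds the Bellman minimum by the form of
    -- `Huu` at `e`, which is at least that of `R`.
    have hPx : r * (e ⬝ᵥ e) + S.γ * (qform G (S.Acl K *ᵥ x) + qform G (S.Ccl K *ᵥ x))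
        ≤ qform G x := by
      rw [h.qform_eq x, S.bellman_gainOf_add hR hγ hG x (L *ᵥ x), bellman, Acl_mulVec, Ccl_mulVec]
      have h1 : qform (S.Huu G) (L *ᵥ x - K *ᵥ x) = qform (S.Huu G) e := by
        rw [← qform_neg_vec, neg_sub]
      have h2 := S.qform_R_le_Huu hγ hGpos e
      rw [← hK, h1]
      linarith [hRr e, cost_nonneg hQ hR x (K *ᵥ x)]
    have hsum : S.γ * (qform Y (S.Acl K *ᵥ x) + qform Y (S.Ccl K *ᵥ x))
        ≤ (1 + ε) * (qform Y x - x ⬝ᵥ x) + (1 + ε⁻¹) * (b₁ + b₂) * (e ⬝ᵥ e) := by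
      have h1 : qform Y (S.Acl K *ᵥ x) + qform Y (S.Ccl K *ᵥ x)
          ≤ (1 + ε) * (qform Y (S.Acl L *ᵥ x) + qform Y (S.Ccl L *ᵥ x))
            + (1 + ε⁻¹) * (b₁ + b₂) * (e ⬝ᵥ e) := by
        have h3 : (1 + ε⁻¹) * (qform Y (S.B *ᵥ e) + qform Y (S.D *ᵥ e))
            ≤ (1 + ε⁻¹) * ((b₁ + b₂) * (e ⬝ᵥ e)) :=
          mul_le_mul_of_nonneg_left (by linarith) (by positivity)
        linarith
      have h2 := mul_le_mul_of_nonneg_left h1 hγ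
      have h4 : S.γ * ((1 + ε⁻¹) * (b₁ + b₂) * (e ⬝ᵥ e)) ≤ (1 + ε⁻¹) * (b₁ + b₂) * (e ⬝ᵥ e) :=
        mul_le_of_le_one_left (by positivity) hγ1.le
      have h5 : (1 + ε) * (S.γ * (qform Y (S.Acl L *ᵥ x) + qform Y (S.Ccl L *ᵥ x)))
          ≤ (1 + ε) * (qform Y x - x ⬝ᵥ x) :=
        mul_le_mul_of_nonneg_left (by linarith) (by positivity)
      linarith
    have hεs : ε * qform Y x ≤ 1 / 2 * (x ⬝ᵥ x) := by
      calc ε * qform Y x ≤ ε * (s * (x ⬝ᵥ x)) := mul_le_mul_of_nonneg_left hsx hε0.le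
        _ = 1 / 2 * (x ⬝ᵥ x) := by rw [hε]; field_simp
    have hbP := mul_le_mul_of_nonneg_left hPx hb0.le
    have hxx := mul_nonneg hε0.le (dotProduct_self_nonneg' x)
    have hbre : b * (r * (e ⬝ᵥ e)) = (1 + ε⁻¹) * (b₁ + b₂) * (e ⬝ᵥ e) := by
      rw [← mul_assoc, hbr]
    simp only [qform_dualMap, qform_smul, qform_add]
    linarith

/-- Comparison applied to `G - G'`: a Bellman subsolution for a stable gain lies below the cost
kernel. Riccati solutions are subsolutions for every gain at once. -/
lemma DiscountStable.le_of_le_bellman {L : Matrix (Fin m) (Fin n) ℝ} {G G' : Matrix (Fin n) (Fin n) ℝ}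
    (hL : S.DiscountStable L) (h : S.IsCostKernel L G) (hγ : 0 ≤ S.γ)
    (hle : ∀ x, qform G' x ≤ S.bellman G' x (L *ᵥ x))
    (x : Fin n → ℝ) : qform G' x ≤ qform G x := by
  have h1 := hL.comparison S hγ (X := G - G') (fun x => by
    have h2 := hle x
    rw [qform_dualMap, qform_sub, qform_sub, qform_sub, h.qform_eq x, Acl_mulVec, Ccl_mulVec]
    simp only [bellman] at h2 ⊢
    linarith) x
  rw [qform_sub] at h1
  linarith

lemma qform_eq_bellman_of_sare (hQ : S.Q.PosSemidef) (hR : S.R.PosDef) (hγ : 0 ≤ S.γ)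
    {G : Matrix (Fin n) (Fin n) ℝ} (hG : G.PosSemidef) (h : S.SARE G) (x : Fin n → ℝ) :
    qform G x = S.bellman G x (S.gainOf G *ᵥ x) := by
  rw [← qform_lyap, ← (S.sare_iff hQ hR hγ hG).1 h]

lemma qform_le_bellman_of_sare (hQ : S.Q.PosSemidef) (hR : S.R.PosDef) (hγ : 0 ≤ S.γ)
    {G : Matrix (Fin n) (Fin n) ℝ} (hG : G.PosSemidef) (h : S.SARE G) (x : Fin n → ℝ)
    (u : Fin m → ℝ) : qform G x ≤ S.bellman G x u :=
  (qform_eq_bellman_of_sare hQ hR hγ hG h x).trans_le (S.bellman_gainOf_le hR hγ hG x u)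

/-- Cost kernels and gains of an exact policy iteration. -/
structure IsKernelIteration (S : LQRData n m) (L : ℕ → Matrix (Fin m) (Fin n) ℝ)
    (G : ℕ → Matrix (Fin n) (Fin n) ℝ) : Prop where
  kernel : ∀ i, S.IsCostKernel (L i) (G i)
  improve : ∀ i, L (i + 1) = S.gainOf (G i)

section

variable {L : ℕ → Matrix (Fin m) (Fin n) ℝ} {G : ℕ → Matrix (Fin n) (Fin n) ℝ}

lemma IsKernelIteration.stable (h : S.IsKernelIteration L G) (h0 : S.DiscountStable (L 0))
    (hQ : S.Q.PosSemidef) (hR : S.R.PosDef) (hγ : 0 ≤ S.γ) (hγ1 : S.γ < 1) (i : ℕ) :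
    S.DiscountStable (L i) := by
  induction i with
  | zero => exact h0
  | succ i ih =>
    rw [h.improve]
    exact ih.gainOf (h.kernel i) hQ hR hγ hγ1

/-- The greedy gain lowers the Bellman expression of `G i` below its value at `L i`, which is `G i`
itself. So `G i` is a supersolution for the next gain, and comparison places it above the next
kernel. -/
lemma IsKernelIteration.antitone (h : S.IsKernelIteration L G) (h0 : S.DiscountStable (L 0))
    (hQ : S.Q.PosSemidef) (hR : S.R.PosDef) (hγ : 0 ≤ S.γ) (hγ1 : S.γ < 1) (i : ℕ)
    (x : Fin n → ℝ) : qform (G (i + 1)) x ≤ qform (G i) x := by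
  have hG := (h.kernel i).posSemidef hQ hR hγ (h.stable h0 hQ hR hγ hγ1 i)
  have h1 := (h.stable h0 hQ hR hγ hγ1 (i + 1)).comparison S hγ (X := G i - G (i + 1))
    (fun x => by
      have h2 := S.bellman_gainOf_le hR hγ hG x (L i *ᵥ x)
      rw [← (h.kernel i).qform_eq, ← h.improve] at h2
      rw [qform_dualMap, qform_sub, qform_sub, qform_sub, (h.kernel (i + 1)).qform_eq x,
        Acl_mulVec, Ccl_mulVec]
      simp only [bellman] at h2 ⊢
      linarith) x
  rw [qform_sub] at h1
  linarith

lemma continuousAt_gainOf (hR : S.R.PosDef) (hγ : 0 ≤ S.γ) {G : Matrix (Fin n) (Fin n) ℝ}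
    (hG : G.PosSemidef) : ContinuousAt S.gainOf G := by
  have hdet : (S.Huu G).det ≠ 0 :=
    ((Matrix.isUnit_iff_isUnit_det _).1 (S.Huu_posDef hR hγ hG).isUnit).ne_zero
  have hinv : ContinuousAt (Inv.inv : Matrix (Fin m) (Fin m) ℝ → _) (S.Huu G) := by
    refine continuousAt_matrix_inv _ ?_
    rw [Ring.inverse_eq_inv']
    exact continuousAt_inv₀ hdet
  have hU : Continuous S.Huu := by unfold Huu; fun_prop
  have hux : Continuous S.Hux := by unfold Hux; fun_prop
  have h1 : ContinuousAt (fun G => (S.Huu G)⁻¹) G :=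
    ContinuousAt.comp (f := S.Huu) hinv hU.continuousAt
  have hm : Continuous fun p : Matrix (Fin m) (Fin m) ℝ × Matrix (Fin m) (Fin n) ℝ =>
      -(p.1 * p.2) := by fun_prop
  exact ContinuousAt.comp (f := fun G => ((S.Huu G)⁻¹, S.Hux G)) hm.continuousAt
    (h1.prodMk hux.continuousAt)

lemma continuous_kernelOf : Continuous S.kernelOf := by
  unfold kernelOf Hxx Hxu Hux Huu
  fun_prop

/-- Decreasing nonnegative forms converge, and continuity carries the Lyapunov equations to the
limit. Each positive semidefinite solution is below every iterate, hence below the limit; no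
stability of the limit gain enters. -/
lemma IsKernelIteration.exists_limit (h : S.IsKernelIteration L G)
    (h0 : S.DiscountStable (L 0)) (hQ : S.Q.PosSemidef) (hR : S.R.PosDef) (hγ : 0 ≤ S.γ)
    (hγ1 : S.γ < 1) :
    ∃ G', Tendsto G atTop (𝓝 G') ∧ S.IsGreatestSARE G' := by
  have hpsd : ∀ i, (G i).PosSemidef := fun i =>
    (h.kernel i).posSemidef hQ hR hγ (h.stable h0 hQ hR hγ hγ1 i)
  obtain ⟨G', hG'⟩ := tendsto_of_qform_antitone (fun k => (h.kernel k).1)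
    (fun k => (posSemidef_iff_qform.1 (hpsd k)).2) (h.antitone h0 hQ hR hγ hγ1)
  have hq : ∀ x, Tendsto (fun i => qform (G i) x) atTop (𝓝 (qform G' x)) := fun x =>
    ((continuous_qform x).tendsto G').comp hG'
  have hsymm : G'.IsSymm := by
    have h1 : Tendsto (fun i => (G i)ᵀ) atTop (𝓝 G'ᵀ) :=
      ((continuous_id.matrix_transpose).tendsto G').comp hG'
    exact tendsto_nhds_unique h1 (hG'.congr fun i => (h.kernel i).1.eq.symm)
  have hG'psd : G'.PosSemidef := posSemidef_iff_qform.2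
    ⟨hsymm, fun x => ge_of_tendsto' (hq x) fun i => (posSemidef_iff_qform.1 (hpsd i)).2 x⟩
  have hgain : Tendsto (fun i => L (i + 1)) atTop (𝓝 (S.gainOf G')) :=
    ((continuousAt_gainOf hR hγ hG'psd).tendsto.comp hG').congr fun i => (h.improve i).symm
  have hlyap : G' = S.lyap (S.gainOf G') G' := by
    have hc : Continuous fun p : Matrix (Fin m) (Fin n) ℝ × Matrix (Fin n) (Fin n) ℝ =>
        S.lyap p.1 p.2 := by
      unfold lyap dualMap Acl Ccl
      fun_prop
    -- The gain at `i + 1` comes from the kernel at `i`, so the equation is read at index `i + 1`,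
    -- where both factors are known to converge.
    have h1 := hG'.comp (tendsto_add_atTop_nat 1)
    have h2 := (hc.tendsto (S.gainOf G', G')).comp (hgain.prodMk_nhds h1)
    exact tendsto_nhds_unique h1 (h2.congr fun i => (h.kernel (i + 1)).2.symm)
  have hsare := (S.sare_iff hQ hR hγ hG'psd).2 hlyap
  refine ⟨G', hG', hG'psd, hsare, fun X hX hXs => posSemidef_iff_qform.2 ⟨?_, fun x => ?_⟩⟩
  · exact hsymm.sub (posSemidef_iff_qform.1 hX).1
  · rw [qform_sub, sub_nonneg]
    exact ge_of_tendsto' (hq x) fun i => (h.stable h0 hQ hR hγ hγ1 i).le_of_le_bellman (h.kernel i)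
      hγ (fun y => qform_le_bellman_of_sare hQ hR hγ hX hXs y _) x

end

/-- If the form of `Q` is at least `r` times the squared norm, a solution dissipates that much per
step. It therefore dominates `r • 1`, and `r⁻¹ • G` is a Lyapunov certificate for its own gain. -/
lemma posDef_of_sare (hQ : S.Q.PosDef) (hR : S.R.PosDef) (hγ : 0 ≤ S.γ)
    {G : Matrix (Fin n) (Fin n) ℝ} (hG : G.PosSemidef) (h : S.SARE G) :
    G.PosDef ∧ S.DiscountStable (S.gainOf G) := by
  obtain ⟨r, hr, hQr⟩ := hQ.exists_le_qform
  obtain ⟨hs, hpos⟩ := posSemidef_iff_qform.1 hG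
  have hle : ∀ x, r * (x ⬝ᵥ x) + S.γ * qform (S.dualMap (S.gainOf G) G) x ≤ qform G x := by
    intro x
    rw [qform_eq_bellman_of_sare hQ.posSemidef hR hγ hG h, bellman, cost_eq, qform_dualMap,
      Acl_mulVec, Ccl_mulVec]
    linarith [hQr x, (posSemidef_iff_qform.1 hR.posSemidef).2 (S.gainOf G *ᵥ x)]
  refine ⟨posDef_of_le_qform hs hr fun x => ?_, r⁻¹ • G, fun x => ?_, fun x => ?_⟩
  · have h1 := mul_nonneg hγ (add_nonneg (hpos (S.Acl (S.gainOf G) *ᵥ x))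
      (hpos (S.Ccl (S.gainOf G) *ᵥ x)))
    rw [← qform_dualMap] at h1
    linarith [hle x]
  · rw [qform_smul]
    exact mul_nonneg (by positivity) (hpos x)
  · rw [dualMap_smul, qform_smul, qform_smul]
    have h1 := mul_le_mul_of_nonneg_left (hle x) (inv_pos.2 hr).le
    rw [mul_add, inv_mul_cancel_left₀ hr.ne'] at h1
    linarith

/-- For positive definite `Q` any solution `G'` is the cost kernel of a stable gain, so it dominates
every subsolution, the greatest solution included. -/
lemma IsGreatestSARE.eq_of_posDef {G G' : Matrix (Fin n) (Fin n) ℝ} (hG : S.IsGreatestSARE G)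
    (hQ : S.Q.PosDef) (hR : S.R.PosDef) (hγ : 0 ≤ S.γ) (hG' : G'.PosSemidef) (h : S.SARE G') :
    G' = G := by
  have hs' := (posSemidef_iff_qform.1 hG').1
  have hstab := (posDef_of_sare hQ hR hγ hG' h).2
  refine eq_of_qform_eq hs' (posSemidef_iff_qform.1 hG.1).1 fun x => le_antisymm ?_ ?_
  · have := (posSemidef_iff_qform.1 (hG.2.2 G' hG' h)).2 x
    rw [qform_sub] at this
    linarith
  · exact hstab.le_of_le_bellman ⟨hs', (S.sare_iff hQ.posSemidef hR hγ hG').1 h⟩ hγ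
      (fun y => qform_le_bellman_of_sare hQ.posSemidef hR hγ hG.1 hG.2.1 y _) x

end PolicyIteration

end LQRData

/-! ### Second moments and expected quadratic forms. -/

section Moments

variable {Ω : Type*} [MeasurableSpace Ω] {P : Measure Ω}

lemma integrable_mul_of_memLp_two {f g : Ω → ℝ} (hf : MemLp f 2 P) (hg : MemLp g 2 P) :
    Integrable (fun ω => f ω * g ω) P :=
  hf.integrable_mul hg

lemma integrable_and_integral_mul_of_indepFun {f g : Ω → ℝ} (h : IndepFun f g P)
    (hf : Integrable f P) (hg : Integrable g P) :
    Integrable (fun ω => f ω * g ω) P ∧ ∫ ω, f ω * g ω ∂P = (∫ ω, f ω ∂P) * ∫ ω, g ω ∂P :=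
  ⟨h.integrable_mul hf hg,
    h.integral_fun_mul_eq_mul_integral hf.aestronglyMeasurable hg.aestronglyMeasurable⟩

/-- Of the nine products, the mixed ones factor by independence from the noise and vanish by the
zero means. In the terms containing `d v` or `d v'` uncorrelatedness suffices: `d` need not be
independent of `v` and `v'`. -/
lemma integral_affine_mul_affine [IsProbabilityMeasure P] {a b a' b' d v v' : Ω → ℝ}
    (ha : MemLp a 2 P) (hb : MemLp b 2 P)
    (ha' : MemLp a' 2 P) (hb' : MemLp b' 2 P) (hd : MemLp d 2 P) (hv : MemLp v 2 P)
    (hv' : MemLp v' 2 P)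
    (hind : IndepFun (fun ω => (a ω, b ω, a' ω, b' ω)) (fun ω => (d ω, v ω, v' ω)) P)
    (hd1 : ∫ ω, d ω ∂P = 0) (hd2 : ∫ ω, d ω * d ω ∂P = 1) (hv1 : ∫ ω, v ω ∂P = 0)
    (hv1' : ∫ ω, v' ω ∂P = 0) (hdv : ∫ ω, d ω * v ω ∂P = 0) (hdv' : ∫ ω, d ω * v' ω ∂P = 0) :
    ∫ ω, (a ω + d ω * b ω + v ω) * (a' ω + d ω * b' ω + v' ω) ∂P
      = ∫ ω, a ω * a' ω ∂P + ∫ ω, b ω * b' ω ∂P + ∫ ω, v ω * v' ω ∂P := by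
  have one : (1 : ℝ≥0∞) ≤ 2 := by norm_num
  have key : ∀ (f : ℝ × ℝ × ℝ × ℝ → ℝ) (g : ℝ × ℝ × ℝ → ℝ), Measurable f → Measurable g →
      Integrable (fun ω => f (a ω, b ω, a' ω, b' ω)) P →
      Integrable (fun ω => g (d ω, v ω, v' ω)) P →
      Integrable (fun ω => f (a ω, b ω, a' ω, b' ω) * g (d ω, v ω, v' ω)) P ∧
      ∫ ω, f (a ω, b ω, a' ω, b' ω) * g (d ω, v ω, v' ω) ∂P
        = (∫ ω, f (a ω, b ω, a' ω, b' ω) ∂P) * ∫ ω, g (d ω, v ω, v' ω) ∂P :=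
    fun f g hf hg => integrable_and_integral_mul_of_indepFun (hind.comp hf hg)
  obtain ⟨i1, e1⟩ := key (fun p => p.1 * p.2.2.2) (fun q => q.1) (by fun_prop) (by fun_prop)
    (integrable_mul_of_memLp_two ha hb') (hd.integrable one)
  obtain ⟨i2, e2⟩ := key (fun p => p.1) (fun q => q.2.2) (by fun_prop) (by fun_prop)
    (ha.integrable one) (hv'.integrable one)
  obtain ⟨i3, e3⟩ := key (fun p => p.2.1 * p.2.2.1) (fun q => q.1) (by fun_prop) (by fun_prop)
    (integrable_mul_of_memLp_two hb ha') (hd.integrable one)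
  obtain ⟨i4, e4⟩ := key (fun p => p.2.1 * p.2.2.2) (fun q => q.1 * q.1) (by fun_prop)
    (by fun_prop) (integrable_mul_of_memLp_two hb hb') (integrable_mul_of_memLp_two hd hd)
  obtain ⟨i5, e5⟩ := key (fun p => p.2.1) (fun q => q.1 * q.2.2) (by fun_prop)
    (by fun_prop) (hb.integrable one) (integrable_mul_of_memLp_two hd hv')
  obtain ⟨i6, e6⟩ := key (fun p => p.2.2.1) (fun q => q.2.1) (by fun_prop)
    (by fun_prop) (ha'.integrable one) (hv.integrable one)
  obtain ⟨i7, e7⟩ := key (fun p => p.2.2.2) (fun q => q.1 * q.2.1) (by fun_prop)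
    (by fun_prop) (hb'.integrable one) (integrable_mul_of_memLp_two hd hv)
  have i0 := integrable_mul_of_memLp_two ha ha'
  have i8 := integrable_mul_of_memLp_two hv hv'
  simp only [hd1, hv1', hd2, hdv', hv1, hdv, mul_zero, mul_one] at e1 e2 e3 e4 e5 e6 e7
  have he : (fun ω => (a ω + d ω * b ω + v ω) * (a' ω + d ω * b' ω + v' ω)) = fun ω =>
      a ω * a' ω + a ω * b' ω * d ω + a ω * v' ω + b ω * a' ω * d ω + b ω * b' ω * (d ω * d ω)
      + b ω * (d ω * v' ω) + a' ω * v ω + b' ω * (d ω * v ω) + v ω * v' ω := by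
    funext ω
    ring
  have add : ∀ {f g : Ω → ℝ} {x y : ℝ}, (Integrable f P ∧ ∫ ω, f ω ∂P = x) →
      (Integrable g P ∧ ∫ ω, g ω ∂P = y) →
      Integrable (fun ω => f ω + g ω) P ∧ ∫ ω, f ω + g ω ∂P = x + y :=
    fun hf hg => ⟨hf.1.add hg.1, by rw [integral_add hf.1 hg.1, hf.2, hg.2]⟩
  have := (add (add (add (add (add (add (add (add ⟨i0, rfl⟩ ⟨i1, e1⟩) ⟨i2, e2⟩) ⟨i3, e3⟩)
    ⟨i4, e4⟩) ⟨i5, e5⟩) ⟨i6, e6⟩) ⟨i7, e7⟩) ⟨i8, rfl⟩).2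
  rw [he]
  refine this.trans ?_
  ring

lemma memLp_mulVec {ι κ : Type*} [Fintype ι] [Fintype κ] (M : Matrix ι κ ℝ) {x : Ω → κ → ℝ}
    {p : ℝ≥0∞} (hx : MemLp x p P) : MemLp (fun ω => M *ᵥ x ω) p P :=
  (M.mulVecLin.toContinuousLinearMap).comp_memLp' hx

lemma memLp_apply {ι : Type*} [Fintype ι] {x : Ω → ι → ℝ} {p : ℝ≥0∞} (hx : MemLp x p P)
    (i : ι) : MemLp (fun ω => x ω i) p P :=
  (ContinuousLinearMap.proj (R := ℝ) (φ := fun _ : ι => ℝ) i).comp_memLp' hx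

lemma integrable_qform {ι : Type*} [Fintype ι] (G : Matrix ι ι ℝ) {x : Ω → ι → ℝ}
    (hx : MemLp x 2 P) : Integrable (fun ω => qform G (x ω)) P := by
  simp only [qform_eq_sum]
  exact integrable_finsetSum _ fun i _ => integrable_finsetSum _ fun j _ =>
    (integrable_mul_of_memLp_two (memLp_apply hx i) (memLp_apply hx j)).const_mul _

lemma integral_qform {n : ℕ} (G : Matrix (Fin n) (Fin n) ℝ) {x : Ω → Fin n → ℝ}
    (hx : MemLp x 2 P) :
    ∫ ω, qform G (x ω) ∂P = ∑ i, ∑ j, G i j * secondMoment P x i j := by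
  have hij : ∀ i j, Integrable (fun ω => G i j * (x ω i * x ω j)) P := fun i j =>
    (integrable_mul_of_memLp_two (memLp_apply hx i) (memLp_apply hx j)).const_mul _
  simp only [qform_eq_sum]
  rw [integral_finsetSum _ fun i _ => integrable_finsetSum _ fun j _ => hij i j]
  refine Finset.sum_congr rfl fun i _ => ?_
  rw [integral_finsetSum _ fun j _ => hij i j]
  refine Finset.sum_congr rfl fun j _ => ?_
  rw [integral_const_mul]
  rfl

end Moments

/-! ### Moments, time shift and independence of the noise. -/

section Noise

variable {Ω : Type*} [MeasurableSpace Ω] {P : Measure Ω} {n m : ℕ}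
  {W : Matrix (Fin n) (Fin n) ℝ} {d : ℕ → Ω → ℝ} {w : ℕ → Ω → Fin n → ℝ}

lemma IsNoise.memLp_d (h : IsNoise P W d w) (k : ℕ) : MemLp (d k) 2 P := by
  have h1 : MemLp id 2 (P.map (d k)) := by
    rw [h.law_d]
    exact IsGaussian.memLp_two_id
  exact (memLp_map_measure_iff (by fun_prop) (h.measurable_d k).aemeasurable).1 h1

lemma IsNoise.memLp_w (h : IsNoise P W d w) (k : ℕ) : MemLp (w k) 2 P :=
  (h.gaussian_w k).memLp_two

lemma IsNoise.integral_d (h : IsNoise P W d w) (k : ℕ) : ∫ ω, d k ω ∂P = 0 := by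
  have h1 : ∫ x, x ∂(P.map (d k)) = 0 := by
    rw [h.law_d]
    exact integral_id_gaussianReal
  rwa [integral_map (h.measurable_d k).aemeasurable (by fun_prop)] at h1

lemma IsNoise.integral_d_mul_d (h : IsNoise P W d w) (k : ℕ) : ∫ ω, d k ω * d k ω ∂P = 1 := by
  have h1 : ∫ x : ℝ, x * x ∂(P.map (d k)) = 1 := by
    rw [h.law_d]
    have h2 := variance_id_gaussianReal (μ := 0) (v := 1)
    rw [variance_eq_integral (by fun_prop)] at h2
    simpa [pow_two] using h2
  rwa [integral_map (h.measurable_d k).aemeasurable (by fun_prop)] at h1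

lemma IsNoise.isSymm (h : IsNoise P W d w) : W.IsSymm := by
  ext i j
  rw [Matrix.transpose_apply, ← h.cov_w 0, ← h.cov_w 0]
  simp only [mul_comm]

lemma IsNoise.shift (h : IsNoise P W d w) :
    IsNoise P W (fun k => d (k + 1)) (fun k => w (k + 1)) where
  measurable_d := fun _ => h.measurable_d _
  measurable_w := fun _ => h.measurable_w _
  law_d := fun _ => h.law_d _
  gaussian_w := fun _ => h.gaussian_w _
  mean_w := fun _ => h.mean_w _
  cov_w := fun _ => h.cov_w _
  uncorrelated := fun _ _ => h.uncorrelated _ _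
  indep := h.indep.precomp (g := fun k => k + 1) (add_left_injective 1)

/-- If `X` is independent of `(Y, Z)` and `Y` is independent of `Z`, then `(X, Y)` is independent
of `Z`. -/
lemma indepFun_prodMk_left {α β δ : Type*} [MeasurableSpace α] [MeasurableSpace β]
    [MeasurableSpace δ] [IsProbabilityMeasure P] {X : Ω → α} {Y : Ω → β} {Z : Ω → δ}
    (hX : Measurable X) (hY : Measurable Y) (hZ : Measurable Z)
    (h : IndepFun X (fun ω => (Y ω, Z ω)) P) (hYZ : IndepFun Y Z P) :
    IndepFun (fun ω => (X ω, Y ω)) Z P := by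
  have hXY : IndepFun X Y P := h.comp measurable_id measurable_fst
  rw [indepFun_iff_map_prod_eq_prod_map_map (by fun_prop) (by fun_prop)] at h hYZ hXY ⊢
  have := Measure.isProbabilityMeasure_map (μ := P) hX.aemeasurable
  have := Measure.isProbabilityMeasure_map (μ := P) hY.aemeasurable
  have := Measure.isProbabilityMeasure_map (μ := P) hZ.aemeasurable
  have e : (fun ω => ((X ω, Y ω), Z ω))
      = MeasurableEquiv.prodAssoc.symm ∘ fun ω => (X ω, (Y ω, Z ω)) := rfl
  rw [e, ← Measure.map_map (by fun_prop) (by fun_prop), h, hYZ, hXY, ← Measure.prodAssoc_prod,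
    Measure.map_map (by fun_prop) (by fun_prop)]
  simp

lemma IsNoise.indepFun_head_tail (h : IsNoise P W d w) :
    IndepFun (fun ω => (d 0 ω, w 0 ω)) (fun ω k => (d (k + 1) ω, w (k + 1) ω)) P := by
  have hm : ∀ k, Measurable fun ω => (d k ω, w k ω) := fun k =>
    (h.measurable_d k).prodMk (h.measurable_w k)
  have h1 := indep_iSup_of_disjoint (fun k => (hm k).comap_le) h.indep
    (S := {0}) (T := Set.range Nat.succ) (by simp)
  refine indep_of_indep_of_le_left (indep_of_indep_of_le_right h1 ?_) ?_
  -- The whole tail process is measurable for the join of the σ-algebras with positive index.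
  · refine Measurable.comap_le (@measurable_pi_lambda _ _ _ (_) _ _ fun k => ?_)
    refine (comap_measurable _).mono ?_ le_rfl
    exact le_iSup₂_of_le (f := fun k _ => MeasurableSpace.comap (fun ω => (d k ω, w k ω)) _)
      (k + 1) ⟨k, rfl⟩ le_rfl
  · exact le_iSup₂_of_le (f := fun k _ => MeasurableSpace.comap (fun ω => (d k ω, w k ω)) _)
      0 rfl le_rfl

/-- This drives induction on time: after one step the new state is again independent of the
remaining noise. The general `f` covers feedback inputs and arbitrary ones. -/
lemma IsNoise.indepFun_step [IsProbabilityMeasure P] (h : IsNoise P W d w) {E F : Type*}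
    [MeasurableSpace E] [MeasurableSpace F] {ξ : Ω → E} (hξ : Measurable ξ)
    (hind : IndepFun ξ (fun ω k => (d k ω, w k ω)) P)
    {f : E × ℝ × (Fin n → ℝ) → F} (hf : Measurable f) :
    IndepFun (fun ω => f (ξ ω, d 0 ω, w 0 ω)) (fun ω k => (d (k + 1) ω, w (k + 1) ω)) P := by
  have hm : ∀ k, Measurable fun ω => (d k ω, w k ω) := fun k =>
    (h.measurable_d k).prodMk (h.measurable_w k)
  have h1 : IndepFun ξ (fun ω => ((d 0 ω, w 0 ω), fun k => (d (k + 1) ω, w (k + 1) ω))) P :=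
    hind.comp (φ := id) (ψ := fun g : ℕ → ℝ × (Fin n → ℝ) => (g 0, fun k => g (k + 1)))
      measurable_id (by fun_prop)
  exact (indepFun_prodMk_left hξ (hm 0) (measurable_pi_lambda _ fun k => hm (k + 1)) h1
    h.indepFun_head_tail).comp hf measurable_id

end Noise

namespace LQRData

/-! ### One-step moment identities and trajectories. -/

section Dynamics

variable {n m : ℕ} {S : LQRData n m} {Ω : Type*} [MeasurableSpace Ω] {P : Measure Ω}
  {d : ℕ → Ω → ℝ} {w : ℕ → Ω → Fin n → ℝ}

lemma step_apply (x : Fin n → ℝ) (u : Fin m → ℝ) (a : ℝ) (v : Fin n → ℝ) (i : Fin n) :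
    S.step x u a v i = (S.A *ᵥ x + S.B *ᵥ u) i + a * (S.C *ᵥ x + S.D *ᵥ u) i + v i := by
  simp [step]
  ring

lemma measurable_mulVec {α ι κ : Type*} [MeasurableSpace α] [Fintype ι] [Fintype κ]
    (M : Matrix ι κ ℝ) {x : α → κ → ℝ} (hx : Measurable x) : Measurable fun ω => M *ᵥ x ω :=
  (M.mulVecLin.toContinuousLinearMap.continuous.measurable).comp hx

lemma measurable_step {α : Type*} [MeasurableSpace α] {x : α → Fin n → ℝ} {u : α → Fin m → ℝ}
    {a : α → ℝ} {v : α → Fin n → ℝ} (hx : Measurable x) (hu : Measurable u) (ha : Measurable a)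
    (hv : Measurable v) : Measurable fun ω => S.step (x ω) (u ω) (a ω) (v ω) :=
  (((measurable_mulVec S.A hx).add (measurable_mulVec S.B hu)).add
    (ha.smul ((measurable_mulVec S.C hx).add (measurable_mulVec S.D hu)))).add hv

lemma measurable_cost {α : Type*} [MeasurableSpace α] {x : α → Fin n → ℝ} {u : α → Fin m → ℝ}
    (hx : Measurable x) (hu : Measurable u) : Measurable fun ω => S.cost (x ω) (u ω) := by
  have h1 := measurable_mulVec S.Q hx
  have h2 := measurable_mulVec S.R hu
  unfold cost dotProduct
  fun_prop

lemma memLp_affine (E : Matrix (Fin n) (Fin n) ℝ) (F : Matrix (Fin n) (Fin m) ℝ)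
    {ξ : Ω → Fin n → ℝ} {η : Ω → Fin m → ℝ} (hξ : MemLp ξ 2 P) (hη : MemLp η 2 P) :
    MemLp (fun ω => E *ᵥ ξ ω + F *ᵥ η ω) 2 P :=
  (memLp_mulVec E hξ).add (memLp_mulVec F hη)

/-- A product of two square-integrable variables need not be square-integrable. For `d k` times the
diffusion term independence helps: its square is a product of independent integrable variables. -/
lemma memLp_step [IsProbabilityMeasure P] (h : IsNoise P S.W d w) (k : ℕ) {ξ : Ω → Fin n → ℝ}
    {η : Ω → Fin m → ℝ} (hξ : MemLp ξ 2 P) (hη : MemLp η 2 P)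
    (hind : IndepFun (fun ω => (ξ ω, η ω)) (fun ω => (d k ω, w k ω)) P) :
    MemLp (fun ω => S.step (ξ ω) (η ω) (d k ω) (w k ω)) 2 P := by
  have ha := memLp_affine S.A S.B hξ hη
  have hb := memLp_affine S.C S.D hξ hη
  refine MemLp.of_eval fun i => ?_
  simp only [step_apply]
  refine ((memLp_apply ha i).add ?_).add (memLp_apply (h.memLp_w k) i)
  have hbi := memLp_apply hb i
  have hd := h.memLp_d k
  refine (memLp_two_iff_integrable_sq (hd.1.mul hbi.1)).2 ?_
  have hi : IndepFun (fun ω => d k ω ^ 2) (fun ω => (S.C *ᵥ ξ ω + S.D *ᵥ η ω) i ^ 2) P :=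
    hind.symm.comp (φ := fun p : ℝ × (Fin n → ℝ) => p.1 ^ 2)
      (ψ := fun p : (Fin n → ℝ) × (Fin m → ℝ) => (S.C *ᵥ p.1 + S.D *ᵥ p.2) i ^ 2)
      (by fun_prop) (Continuous.measurable (by fun_prop))
  refine (hi.integrable_mul hd.integrable_sq hbi.integrable_sq).congr (ae_of_all _ fun ω => ?_)
  simp [mul_pow]

lemma secondMoment_step [IsProbabilityMeasure P] (h : IsNoise P S.W d w) (k : ℕ)
    {ξ : Ω → Fin n → ℝ} {η : Ω → Fin m → ℝ} (hξ : MemLp ξ 2 P) (hη : MemLp η 2 P)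
    (hind : IndepFun (fun ω => (ξ ω, η ω)) (fun ω => (d k ω, w k ω)) P) :
    secondMoment P (fun ω => S.step (ξ ω) (η ω) (d k ω) (w k ω))
      = secondMoment P (fun ω => S.A *ᵥ ξ ω + S.B *ᵥ η ω)
        + secondMoment P (fun ω => S.C *ᵥ ξ ω + S.D *ᵥ η ω) + S.W := by
  have ha := memLp_affine S.A S.B hξ hη
  have hb := memLp_affine S.C S.D hξ hη
  ext i j
  simp only [secondMoment, Matrix.of_apply, Matrix.add_apply, step_apply, ← h.cov_w k i j]
  refine integral_affine_mul_affine (memLp_apply ha i) (memLp_apply hb i) (memLp_apply ha j)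
    (memLp_apply hb j) (h.memLp_d k) (memLp_apply (h.memLp_w k) i) (memLp_apply (h.memLp_w k) j)
    ?_ (h.integral_d k) (h.integral_d_mul_d k) (h.mean_w k i) (h.mean_w k j)
    (h.uncorrelated k k i) (h.uncorrelated k k j)
  exact hind.comp (φ := fun p : (Fin n → ℝ) × (Fin m → ℝ) =>
      ((S.A *ᵥ p.1 + S.B *ᵥ p.2) i, (S.C *ᵥ p.1 + S.D *ᵥ p.2) i,
        (S.A *ᵥ p.1 + S.B *ᵥ p.2) j, (S.C *ᵥ p.1 + S.D *ᵥ p.2) j))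
    (ψ := fun p : ℝ × (Fin n → ℝ) => (p.1, p.2 i, p.2 j))
    (Continuous.measurable (by fun_prop)) (by fun_prop)

lemma trace_mul_eq_sum (h : IsNoise P S.W d w) (G : Matrix (Fin n) (Fin n) ℝ) :
    (G * S.W).trace = ∑ i, ∑ j, G i j * S.W i j := by
  simp only [Matrix.trace, Matrix.diag, Matrix.mul_apply]
  exact Finset.sum_congr rfl fun i _ => Finset.sum_congr rfl fun j _ => by
    rw [h.isSymm.apply]

/-- The trace is the expected value of the form of `G` at `w 0`. -/
lemma trace_mul_noise_nonneg (h : IsNoise P S.W d w)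
    {G : Matrix (Fin n) (Fin n) ℝ} (hG : G.PosSemidef) : 0 ≤ (G * S.W).trace := by
  have h1 := integral_qform G (h.memLp_w 0)
  have h2 : secondMoment P (w 0) = S.W := by
    ext i j
    simp [secondMoment, h.cov_w]
  rw [h2, ← trace_mul_eq_sum h] at h1
  rw [← h1]
  exact integral_nonneg fun ω => (posSemidef_iff_qform.1 hG).2 _

lemma integral_qform_step [IsProbabilityMeasure P] (h : IsNoise P S.W d w) (k : ℕ)
    {ξ : Ω → Fin n → ℝ} {η : Ω → Fin m → ℝ} (hξ : MemLp ξ 2 P) (hη : MemLp η 2 P)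
    (hind : IndepFun (fun ω => (ξ ω, η ω)) (fun ω => (d k ω, w k ω)) P)
    (G : Matrix (Fin n) (Fin n) ℝ) :
    ∫ ω, qform G (S.step (ξ ω) (η ω) (d k ω) (w k ω)) ∂P
      = ∫ ω, qform G (S.A *ᵥ ξ ω + S.B *ᵥ η ω) ∂P
        + ∫ ω, qform G (S.C *ᵥ ξ ω + S.D *ᵥ η ω) ∂P + (G * S.W).trace := by
  have ha := memLp_affine S.A S.B hξ hη
  have hb := memLp_affine S.C S.D hξ hη
  rw [integral_qform G (memLp_step h k hξ hη hind), integral_qform G ha, integral_qform G hb,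
    secondMoment_step h k hξ hη hind, trace_mul_eq_sum h]
  simp only [Matrix.add_apply, mul_add, Finset.sum_add_distrib]

lemma integrable_cost {ξ : Ω → Fin n → ℝ} {η : Ω → Fin m → ℝ} (hξ : MemLp ξ 2 P)
    (hη : MemLp η 2 P) : Integrable (fun ω => S.cost (ξ ω) (η ω)) P :=
  (integrable_qform S.Q hξ).add (integrable_qform S.R hη)

lemma integrable_bellman (G : Matrix (Fin n) (Fin n) ℝ) {ξ : Ω → Fin n → ℝ}
    {η : Ω → Fin m → ℝ} (hξ : MemLp ξ 2 P) (hη : MemLp η 2 P) :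
    Integrable (fun ω => S.bellman G (ξ ω) (η ω)) P :=
  (integrable_cost hξ hη).add (((integrable_qform G
    (memLp_affine S.A S.B hξ hη)).add (integrable_qform G
    (memLp_affine S.C S.D hξ hη))).const_mul S.γ)

/-- Expected one-step cost plus discounted quadratic cost-to-go. -/
lemma integral_cost_add [IsProbabilityMeasure P] (h : IsNoise P S.W d w) (k : ℕ)
    {ξ : Ω → Fin n → ℝ} {η : Ω → Fin m → ℝ} (hξ : MemLp ξ 2 P) (hη : MemLp η 2 P)
    (hind : IndepFun (fun ω => (ξ ω, η ω)) (fun ω => (d k ω, w k ω)) P)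
    (G : Matrix (Fin n) (Fin n) ℝ) :
    ∫ ω, S.cost (ξ ω) (η ω) ∂P
        + S.γ * ∫ ω, qform G (S.step (ξ ω) (η ω) (d k ω) (w k ω)) ∂P
      = ∫ ω, S.bellman G (ξ ω) (η ω) ∂P + S.γ * (G * S.W).trace := by
  have ha := integrable_qform G (memLp_affine S.A S.B hξ hη)
  have hb := integrable_qform G (memLp_affine S.C S.D hξ hη)
  simp only [bellman]
  have hab : Integrable (fun ω => S.γ * (qform G (S.A *ᵥ ξ ω + S.B *ᵥ η ω)
      + qform G (S.C *ᵥ ξ ω + S.D *ᵥ η ω))) P := (ha.add hb).const_mul _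
  rw [integral_add (integrable_cost hξ hη) hab, integral_const_mul,
    integral_add ha hb, integral_qform_step h k hξ hη hind]
  ring

/-- The policy `u_k = L_k x_k`. -/
def gainPolicy (L : ℕ → Matrix (Fin m) (Fin n) ℝ) : ℕ → (Fin n → ℝ) → (Fin m → ℝ) :=
  fun k x => L k *ᵥ x

lemma measurable_gainPolicy (L : ℕ → Matrix (Fin m) (Fin n) ℝ) (k : ℕ) :
    Measurable (gainPolicy L k) :=
  measurable_mulVec (L k) measurable_id

lemma measurable_traj (h : IsNoise P S.W d w) {π : ℕ → (Fin n → ℝ) → (Fin m → ℝ)}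
    (hπ : ∀ k, Measurable (π k)) {ξ : Ω → Fin n → ℝ} (hξ : Measurable ξ) (k : ℕ) :
    Measurable (S.traj d w π ξ k) := by
  induction k with
  | zero => exact hξ
  | succ k ih =>
    exact measurable_step ih ((hπ k).comp ih) (h.measurable_d k) (h.measurable_w k)

/-- `traj` recurses at the last step; peeling off the first one instead matches the time shift of
the noise. -/
lemma traj_succ {Ω : Type*} {d : ℕ → Ω → ℝ} {w : ℕ → Ω → Fin n → ℝ}
    (π : ℕ → (Fin n → ℝ) → (Fin m → ℝ)) (ξ : Ω → Fin n → ℝ) (k : ℕ) :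
    S.traj d w π ξ (k + 1) = S.traj (fun k => d (k + 1)) (fun k => w (k + 1))
      (fun k => π (k + 1)) (fun ω => S.step (ξ ω) (π 0 (ξ ω)) (d 0 ω) (w 0 ω)) k := by
  induction k with
  | zero => rfl
  | succ k ih => rw [traj, ih]; rfl

lemma indepFun_traj [IsProbabilityMeasure P] (h : IsNoise P S.W d w)
    {π : ℕ → (Fin n → ℝ) → (Fin m → ℝ)}
    (hπ : ∀ k, Measurable (π k)) {ξ : Ω → Fin n → ℝ} (hξ : Measurable ξ)
    (hind : IndepFun ξ (fun ω k => (d k ω, w k ω)) P) (k : ℕ) :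
    IndepFun (S.traj d w π ξ k) (fun ω => (d k ω, w k ω)) P := by
  induction k generalizing d w π ξ with
  | zero =>
    exact hind.comp (φ := id) (ψ := fun g : ℕ → ℝ × (Fin n → ℝ) => g 0) measurable_id
      (by fun_prop)
  | succ k ih =>
    rw [traj_succ]
    refine ih h.shift (fun k => hπ (k + 1)) ?_ ?_
    · exact measurable_traj h hπ hξ 1
    · exact h.indepFun_step hξ hind
        (f := fun p : (Fin n → ℝ) × ℝ × (Fin n → ℝ) => S.step p.1 (π 0 p.1) p.2.1 p.2.2)
        (measurable_step measurable_fst ((hπ 0).comp measurable_fst)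
          (measurable_fst.comp measurable_snd) (measurable_snd.comp measurable_snd))

lemma indepFun_traj_input [IsProbabilityMeasure P] (h : IsNoise P S.W d w)
    {π : ℕ → (Fin n → ℝ) → (Fin m → ℝ)} (hπ : ∀ k, Measurable (π k)) {ξ : Ω → Fin n → ℝ}
    (hξ : IsInitial P d w ξ) (k : ℕ) :
    IndepFun (fun ω => (S.traj d w π ξ k ω, π k (S.traj d w π ξ k ω)))
      (fun ω => (d k ω, w k ω)) P :=
  (indepFun_traj h hπ hξ.1 hξ.2.2 k).comp (measurable_id.prodMk (hπ k)) measurable_id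

lemma memLp_traj [IsProbabilityMeasure P] (h : IsNoise P S.W d w)
    (L : ℕ → Matrix (Fin m) (Fin n) ℝ) {ξ : Ω → Fin n → ℝ} (hξ : IsInitial P d w ξ) (k : ℕ) :
    MemLp (S.traj d w (gainPolicy L) ξ k) 2 P := by
  induction k with
  | zero => exact hξ.2.1
  | succ k ih =>
    exact memLp_step h k ih (memLp_mulVec (L k) ih)
      (indepFun_traj_input h (measurable_gainPolicy L) hξ k)

lemma isInitial_const [IsProbabilityMeasure P] (x : Fin n → ℝ) :
    IsInitial P d w (fun _ => x) :=
  ⟨measurable_const, memLp_const x, indepFun_const_left _ _⟩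

lemma isInitial_step [IsProbabilityMeasure P] (h : IsNoise P S.W d w) {ξ : Ω → Fin n → ℝ}
    {η : Ω → Fin m → ℝ} (hz : IsInitial P d w (fun ω => (ξ ω, η ω))) :
    IsInitial P (fun k => d (k + 1)) (fun k => w (k + 1))
      (fun ω => S.step (ξ ω) (η ω) (d 0 ω) (w 0 ω)) := by
  refine ⟨?_, ?_, ?_⟩
  · exact measurable_step (measurable_fst.comp hz.1) (measurable_snd.comp hz.1)
      (h.measurable_d 0) (h.measurable_w 0)
  · exact memLp_step h 0 (memLp_prod_iff.1 hz.2.1).1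
      (memLp_prod_iff.1 hz.2.1).2
      (hz.2.2.comp (φ := id) (ψ := fun g : ℕ → ℝ × (Fin n → ℝ) => g 0) measurable_id
        (by fun_prop))
  · exact h.indepFun_step hz.1 hz.2.2
      (f := fun p : ((Fin n → ℝ) × (Fin m → ℝ)) × ℝ × (Fin n → ℝ) =>
        S.step p.1.1 p.1.2 p.2.1 p.2.2)
      (measurable_step (measurable_fst.comp measurable_fst) (measurable_snd.comp measurable_fst)
        (measurable_fst.comp measurable_snd) (measurable_snd.comp measurable_snd))

lemma traj_congr {Ω : Type*} {d : ℕ → Ω → ℝ} {w : ℕ → Ω → Fin n → ℝ}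
    {π π' : ℕ → (Fin n → ℝ) → (Fin m → ℝ)} (ξ : Ω → Fin n → ℝ) {N : ℕ}
    (hπ : ∀ k < N, π k = π' k) : S.traj d w π ξ N = S.traj d w π' ξ N := by
  induction N with
  | zero => rfl
  | succ N ih =>
    rw [traj, traj, ih fun k hk => hπ k (by omega), hπ N (by omega)]

end Dynamics

/-! ### Admissibility as a property of the system matrices. -/

section Stability

variable {n m : ℕ} {S : LQRData n m} {Ω : Type*} [MeasurableSpace Ω] {P : Measure Ω}
  {d : ℕ → Ω → ℝ} {w : ℕ → Ω → Fin n → ℝ}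

/-- Asymptotic square stationarity of the gain `L`, in terms of the system matrices only. -/
def MeanSquareStationary (S : LQRData n m) (L : Matrix (Fin m) (Fin n) ℝ) : Prop :=
  (∀ G x, Tendsto (fun k => qform ((S.dualMap L)^[k] G) x) atTop (𝓝 0)) ∧
  ∃ X : Matrix (Fin n) (Fin n) ℝ, X.PosSemidef ∧
    ∀ G, Tendsto (fun k => ∑ l ∈ Finset.range k, ((S.dualMap L)^[l] G * S.W).trace) atTop
      (𝓝 (∑ i, ∑ j, G i j * X i j))

lemma integral_qform_traj_succ [IsProbabilityMeasure P] (h : IsNoise P S.W d w)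
    (L : ℕ → Matrix (Fin m) (Fin n) ℝ) {ξ : Ω → Fin n → ℝ} (hξ : IsInitial P d w ξ)
    (G : Matrix (Fin n) (Fin n) ℝ) (k : ℕ) :
    ∫ ω, qform G (S.traj d w (gainPolicy L) ξ (k + 1) ω) ∂P
      = ∫ ω, qform (S.dualMap (L k) G) (S.traj d w (gainPolicy L) ξ k ω) ∂P
        + (G * S.W).trace := by
  have hx := memLp_traj h L hξ k
  have h1 := integral_qform_step h k hx (memLp_mulVec (L k) hx)
    (indepFun_traj_input h (measurable_gainPolicy L) hξ k) G
  refine h1.trans ?_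
  simp only [qform_dualMap, Acl_mulVec, Ccl_mulVec]
  rw [integral_add (integrable_qform G (memLp_affine S.A S.B hx (memLp_mulVec (L k) hx)))
    (integrable_qform G (memLp_affine S.C S.D hx (memLp_mulVec (L k) hx)))]

/-- Dualising the dynamics from time `N` on separates the effect of the state at time `N` from that
of the later noise. Starting at `N` allows for policies that switch gains. -/
lemma integral_qform_traj_add [IsProbabilityMeasure P] (h : IsNoise P S.W d w)
    (L : ℕ → Matrix (Fin m) (Fin n) ℝ) {ξ : Ω → Fin n → ℝ} (hξ : IsInitial P d w ξ)
    {K : Matrix (Fin m) (Fin n) ℝ} {N : ℕ} (hK : ∀ k, N ≤ k → L k = K)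
    (G : Matrix (Fin n) (Fin n) ℝ) (k : ℕ) :
    ∫ ω, qform G (S.traj d w (gainPolicy L) ξ (N + k) ω) ∂P
      = ∫ ω, qform ((S.dualMap K)^[k] G) (S.traj d w (gainPolicy L) ξ N ω) ∂P
        + ∑ l ∈ Finset.range k, ((S.dualMap K)^[l] G * S.W).trace := by
  induction k generalizing G with
  | zero => simp
  | succ k ih =>
    rw [← add_assoc, integral_qform_traj_succ h L hξ, hK (N + k) (by omega), ih,
      Finset.sum_range_succ', Function.iterate_succ_apply]
    simp only [Function.iterate_succ_apply, Function.iterate_zero_apply]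
    ring

/-- Admissibility of a gain in terms of the system matrices. -/
lemma meanSquareStationary_of_admissible [IsProbabilityMeasure P] (h : IsNoise P S.W d w)
    {L : Matrix (Fin m) (Fin n) ℝ} (hL : S.Admissible P d w (linearPolicy L)) :
    S.MeanSquareStationary L := by
  obtain ⟨-, X, hX, hlim⟩ := hL
  have hG : ∀ (G : Matrix (Fin n) (Fin n) ℝ) (x : Fin n → ℝ),
      Tendsto (fun k => qform ((S.dualMap L)^[k] G) x
        + ∑ l ∈ Finset.range k, ((S.dualMap L)^[l] G * S.W).trace) atTop
        (𝓝 (∑ i, ∑ j, G i j * X i j)) := by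
    intro G x
    have hx : IsInitial P d w (fun _ => x) := isInitial_const x
    have h1 : Tendsto (fun k => ∑ i, ∑ j, G i j *
        secondMoment P (S.traj d w (linearPolicy L) (fun _ => x) k) i j) atTop
        (𝓝 (∑ i, ∑ j, G i j * X i j)) :=
      tendsto_finsetSum _ fun i _ => tendsto_finsetSum _ fun j _ =>
        (tendsto_pi_nhds.1 (tendsto_pi_nhds.1 (hlim _ hx).2 i) j).const_mul _
    refine h1.congr fun k => ?_
    rw [← integral_qform G ((hlim _ hx).1 k)]
    have h2 := integral_qform_traj_add h (fun _ => L) hx (N := 0) (K := L) (fun _ _ => rfl) G k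
    rw [zero_add] at h2
    refine h2.trans ?_
    simp [traj]
  -- The initial state `0` isolates the noise sums; subtracting them leaves the homogeneous part,
  -- which must then vanish.
  have h0 : ∀ G, Tendsto (fun k => ∑ l ∈ Finset.range k, ((S.dualMap L)^[l] G * S.W).trace)
      atTop (𝓝 (∑ i, ∑ j, G i j * X i j)) := fun G => by
    refine (hG G 0).congr fun k => ?_
    simp [qform]
  refine ⟨fun G x => ?_, X, hX, h0⟩
  have := (hG G x).sub (h0 G)
  rw [sub_self] at this
  exact this.congr fun k => by ring

/-- The limiting second moment is determined by the eventual gain, so any finite prefix of gains is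
harmless. As `MeanSquareStationary` does not mention the noise, admissibility also transfers to the
shifted noise. -/
lemma admissible_gainPolicy [IsProbabilityMeasure P] (h : IsNoise P S.W d w)
    {K : Matrix (Fin m) (Fin n) ℝ} (hK : S.MeanSquareStationary K)
    (L : ℕ → Matrix (Fin m) (Fin n) ℝ) {N : ℕ} (hLK : ∀ k, N ≤ k → L k = K) :
    S.Admissible P d w (gainPolicy L) := by
  obtain ⟨h0, X, hX, hlim⟩ := hK
  refine ⟨measurable_gainPolicy L, X, hX, fun ξ hξ => ⟨memLp_traj h L hξ, ?_⟩⟩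
  set M := secondMoment P (S.traj d w (gainPolicy L) ξ N) with hM
  have hMs : ∀ i j, M i j = M j i := fun i j => by
    simp [hM, secondMoment, mul_comm]
  have hvanish : ∀ G, Tendsto (fun k => ∑ i, ∑ j, ((S.dualMap K)^[k] G) i j * M i j) atTop
      (𝓝 0) := by
    intro G
    -- Vanishing forms control only the symmetric part of the iterates. This is enough because `M`
    -- is symmetric; `G` stays arbitrary so that a `Matrix.single` can later read off one entry.
    have hsym : ∀ i j, Tendsto (fun k => ((S.dualMap K)^[k] G) i j + ((S.dualMap K)^[k] G) j i)
        atTop (𝓝 0) := by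
      intro i j
      simp only [entry_add_entry]
      simpa using ((h0 G (Pi.single i 1 + Pi.single j 1)).sub (h0 G (Pi.single i 1))).sub
        (h0 G (Pi.single j 1))
    have h1 : Tendsto (fun k => ∑ i, ∑ j,
        (((S.dualMap K)^[k] G) i j + ((S.dualMap K)^[k] G) j i) * (M i j / 2)) atTop
        (𝓝 (∑ i : Fin n, ∑ j : Fin n, 0 * (M i j / 2))) :=
      tendsto_finsetSum _ fun i _ => tendsto_finsetSum _ fun j _ => (hsym i j).mul_const _
    simp only [zero_mul, Finset.sum_const_zero] at h1
    refine h1.congr fun k => ?_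
    simp only [add_mul, Finset.sum_add_distrib]
    rw [Finset.sum_comm (f := fun i j => ((S.dualMap K)^[k] G) j i * (M i j / 2)),
      ← Finset.sum_add_distrib]
    refine Finset.sum_congr rfl fun i _ => ?_
    rw [← Finset.sum_add_distrib]
    refine Finset.sum_congr rfl fun j _ => ?_
    rw [hMs j i]
    ring
  have hquad : ∀ G : Matrix (Fin n) (Fin n) ℝ,
      Tendsto (fun k => ∫ ω, qform G (S.traj d w (gainPolicy L) ξ (N + k) ω) ∂P) atTop
        (𝓝 (∑ i, ∑ j, G i j * X i j)) := by
    intro G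
    have h1 := (hvanish G).add (hlim G)
    rw [zero_add] at h1
    refine h1.congr fun k => ?_
    rw [integral_qform_traj_add h L hξ hLK, integral_qform _ (memLp_traj h L hξ N)]
  refine tendsto_pi_nhds.2 fun i => tendsto_pi_nhds.2 fun j => ?_
  rw [← tendsto_add_atTop_iff_nat N]
  have h1 := hquad (Matrix.single i j 1)
  have h2 : ∀ Y : Matrix (Fin n) (Fin n) ℝ,
      ∑ a, ∑ b, (Matrix.single i j (1 : ℝ)) a b * Y a b = Y i j := by
    intro Y
    simp [Matrix.single_apply, ite_and]
  rw [h2] at h1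
  refine h1.congr fun k => ?_
  rw [integral_qform _ (memLp_traj h L hξ (N + k)), h2, add_comm]

lemma iterate_dualMap_isSymm (L : Matrix (Fin m) (Fin n) ℝ) {G : Matrix (Fin n) (Fin n) ℝ}
    (hG : G.IsSymm) (k : ℕ) : ((S.dualMap L)^[k] G).IsSymm := by
  induction k with
  | zero => exact hG
  | succ k ih => rw [Function.iterate_succ_apply', Matrix.IsSymm, dualMap_transpose, ih.eq]

lemma qform_iterate_dualMap_nonneg (L : Matrix (Fin m) (Fin n) ℝ)
    {G : Matrix (Fin n) (Fin n) ℝ} (hG : ∀ x, 0 ≤ qform G x) (k : ℕ) (x : Fin n → ℝ) :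
    0 ≤ qform ((S.dualMap L)^[k] G) x := by
  induction k generalizing x with
  | zero => exact hG x
  | succ k ih =>
    rw [Function.iterate_succ_apply', qform_dualMap]
    exact add_nonneg (ih _) (ih _)

/-- The iterates `Z k` of the identity tend to zero, so some `Z N` is at most `1 / 2` as a form. For
`Y = 2 ∑_{k<N} Z k` telescoping gives `Y - dualMap L Y = 2 (1 - Z N) ≥ 1`, and `γ < 1` only helps.
The finite sum avoids any question of summability. -/
lemma MeanSquareStationary.discountStable {L : Matrix (Fin m) (Fin n) ℝ}
    (hL : S.MeanSquareStationary L) (hγ1 : S.γ < 1) : S.DiscountStable L := by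
  set Z : ℕ → Matrix (Fin n) (Fin n) ℝ := fun k => (S.dualMap L)^[k] 1 with hZ
  have hZs : ∀ k, (Z k).IsSymm := iterate_dualMap_isSymm L Matrix.isSymm_one
  have hZ0 : ∀ k x, 0 ≤ qform (Z k) x := qform_iterate_dualMap_nonneg L fun x => by
    rw [qform_one]; exact dotProduct_self_nonneg' x
  have hentry : ∀ i j, Tendsto (fun k => Z k i j) atTop (𝓝 0) := by
    intro i j
    have h1 := (((hL.1 1 (Pi.single i 1 + Pi.single j 1)).sub (hL.1 1 (Pi.single i 1))).sub
      (hL.1 1 (Pi.single j 1))).div_const 2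
    simp only [sub_zero, zero_div] at h1
    refine h1.congr fun k => ?_
    have h2 := entry_add_entry (Z k) i j
    rw [(hZs k).apply i j] at h2
    change (qform (Z k) _ - qform (Z k) _ - qform (Z k) _) / 2 = Z k i j
    linarith
  have hsum : Tendsto (fun k => ∑ i, ∑ j, |Z k i j|) atTop
      (𝓝 (∑ i : Fin n, ∑ j : Fin n, |(0 : ℝ)|)) :=
    tendsto_finsetSum _ fun i _ => tendsto_finsetSum _ fun j _ => (hentry i j).abs
  simp only [abs_zero, Finset.sum_const_zero] at hsum
  obtain ⟨N, hN⟩ := (hsum.eventually (gt_mem_nhds (show (0 : ℝ) < 1 / 2 by norm_num))).exists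
  have hY : ∀ x, qform (∑ k ∈ Finset.range N, Z k) x = ∑ k ∈ Finset.range N, qform (Z k) x := by
    intro x
    induction Finset.range N using Finset.induction_on with
    | empty => simp [qform_zero]
    | insert a s ha ih => rw [Finset.sum_insert ha, Finset.sum_insert ha, qform_add, ih]
  refine ⟨(2 : ℝ) • ∑ k ∈ Finset.range N, Z k, fun x => ?_, fun x => ?_⟩
  · rw [qform_smul, hY]
    exact mul_nonneg zero_le_two (Finset.sum_nonneg fun k _ => hZ0 k x)
  · have h1 : qform (S.dualMap L ((2 : ℝ) • ∑ k ∈ Finset.range N, Z k)) x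
        = 2 * ∑ k ∈ Finset.range N, qform (Z (k + 1)) x := by
      rw [dualMap_smul, qform_smul, qform_dualMap, hY, hY, ← Finset.sum_add_distrib]
      congr 1
      refine Finset.sum_congr rfl fun k _ => ?_
      simp only [hZ]
      rw [Function.iterate_succ_apply', qform_dualMap]
    have h2 : ∑ k ∈ Finset.range N, qform (Z (k + 1)) x
        = ∑ k ∈ Finset.range N, qform (Z k) x + qform (Z N) x - x ⬝ᵥ x := by
      have h3 := Finset.sum_range_succ (fun k => qform (Z k) x) N
      have h4 := Finset.sum_range_succ' (fun k => qform (Z k) x) N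
      have h5 : qform (Z 0) x = x ⬝ᵥ x := qform_one x
      linarith
    have h6 : 0 ≤ ∑ k ∈ Finset.range N, qform (Z (k + 1)) x :=
      Finset.sum_nonneg fun k _ => hZ0 (k + 1) x
    have h7 := (le_abs_self _).trans (abs_qform_le (Z N) x)
    have h8 : (∑ i, ∑ j, |Z N i j|) * (x ⬝ᵥ x) ≤ 1 / 2 * (x ⬝ᵥ x) :=
      mul_le_mul_of_nonneg_right hN.le (dotProduct_self_nonneg' x)
    rw [h1, qform_smul, hY]
    nlinarith

end Stability

/-! ### Discounted costs: exact values and bounds on both sides. -/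

section Cost

variable {n m : ℕ} {S : LQRData n m} {Ω : Type*} [MeasurableSpace Ω] {P : Measure Ω}
  {d : ℕ → Ω → ℝ} {w : ℕ → Ω → Fin n → ℝ}

lemma V_eq_tsum (h : IsNoise P S.W d w) {π : ℕ → (Fin n → ℝ) → (Fin m → ℝ)}
    (hπ : ∀ k, Measurable (π k)) {ξ : Ω → Fin n → ℝ} (hξ : Measurable ξ) :
    S.V P d w π ξ = ∑' i : ℕ, ∫⁻ ω, ENNReal.ofReal
      (S.γ ^ i * S.cost (S.traj d w π ξ i ω) (π i (S.traj d w π ξ i ω))) ∂P := by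
  refine lintegral_tsum fun i => ?_
  have hx := measurable_traj h hπ hξ i
  exact ((measurable_cost hx ((hπ i).comp hx)).const_mul _).ennreal_ofReal.aemeasurable

variable (S P d w) in
/-- The expected one-step cost at time `i` under the policy `u_k = L_k x_k`. -/
def expectedCost (L : ℕ → Matrix (Fin m) (Fin n) ℝ) (ξ : Ω → Fin n → ℝ) (i : ℕ) : ℝ :=
  ∫ ω, S.cost (S.traj d w (gainPolicy L) ξ i ω) (L i *ᵥ S.traj d w (gainPolicy L) ξ i ω) ∂P

lemma expectedCost_nonneg (hQ : S.Q.PosSemidef) (hR : S.R.PosDef)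
    (L : ℕ → Matrix (Fin m) (Fin n) ℝ) (ξ : Ω → Fin n → ℝ) (i : ℕ) :
    0 ≤ S.expectedCost P d w L ξ i :=
  integral_nonneg fun _ => cost_nonneg hQ hR _ _

lemma V_gainPolicy [IsProbabilityMeasure P] (h : IsNoise P S.W d w) (hQ : S.Q.PosSemidef)
    (hR : S.R.PosDef) (hγ : 0 ≤ S.γ) (L : ℕ → Matrix (Fin m) (Fin n) ℝ) {ξ : Ω → Fin n → ℝ}
    (hξ : IsInitial P d w ξ) :
    S.V P d w (gainPolicy L) ξ
      = ∑' i : ℕ, ENNReal.ofReal (S.γ ^ i * S.expectedCost P d w L ξ i) := by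
  rw [V_eq_tsum h (measurable_gainPolicy L) hξ.1]
  refine tsum_congr fun i => ?_
  have hx := memLp_traj h L hξ i
  have hi := (integrable_cost (S := S) hx (memLp_mulVec (L i) hx)).const_mul (S.γ ^ i)
  rw [expectedCost, ← integral_const_mul]
  exact (ofReal_integral_eq_lintegral_ofReal hi (ae_of_all _ fun ω =>
    mul_nonneg (pow_nonneg hγ i) (cost_nonneg hQ hR _ _))).symm

/-- Telescoping of the discounted costs while the gain `K` with cost kernel `G` is in use. -/
lemma sum_expectedCost [IsProbabilityMeasure P] (h : IsNoise P S.W d w)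
    (L : ℕ → Matrix (Fin m) (Fin n) ℝ) {ξ : Ω → Fin n → ℝ} (hξ : IsInitial P d w ξ)
    {K : Matrix (Fin m) (Fin n) ℝ} {G : Matrix (Fin n) (Fin n) ℝ} (hG : S.IsCostKernel K G)
    (N j : ℕ) (hK : ∀ i < j, L (N + i) = K) :
    ∑ i ∈ Finset.range j, S.γ ^ (N + i) * S.expectedCost P d w L ξ (N + i)
      = S.γ ^ N * ∫ ω, qform G (S.traj d w (gainPolicy L) ξ N ω) ∂P
        - S.γ ^ (N + j) * ∫ ω, qform G (S.traj d w (gainPolicy L) ξ (N + j) ω) ∂P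
        + (G * S.W).trace * ∑ i ∈ Finset.range j, S.γ ^ (N + i + 1) := by
  induction j with
  | zero => simp
  | succ j ih =>
    have hx := memLp_traj h L hξ (N + j)
    have h1 := integral_cost_add h (N + j) hx (memLp_mulVec (L (N + j)) hx)
      (indepFun_traj_input h (measurable_gainPolicy L) hξ (N + j)) G
    have h2 : ∀ x, S.bellman G x (L (N + j) *ᵥ x) = qform G x := fun x => by
      rw [hK j (Nat.lt_succ_self j), ← hG.qform_eq]
    simp only [h2] at h1
    have h3 : S.expectedCost P d w L ξ (N + j)
        + S.γ * ∫ ω, qform G (S.traj d w (gainPolicy L) ξ (N + (j + 1)) ω) ∂P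
        = ∫ ω, qform G (S.traj d w (gainPolicy L) ξ (N + j) ω) ∂P
          + S.γ * (G * S.W).trace := h1
    rw [Finset.sum_range_succ, Finset.sum_range_succ, ih fun i hi => hK i (by omega)]
    have h4 : S.γ ^ (N + (j + 1)) = S.γ ^ (N + j) * S.γ := by rw [← add_assoc, pow_succ]
    have h5 : S.γ ^ (N + j + 1) = S.γ ^ (N + j) * S.γ := pow_succ _ _
    rw [h4, h5]
    linear_combination S.γ ^ (N + j) * h3

lemma hasSum_geometric_shift (hγ : 0 ≤ S.γ) (hγ1 : S.γ < 1) (N : ℕ) :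
    HasSum (fun i => S.γ ^ (N + i + 1)) (S.γ ^ N * (S.γ / (1 - S.γ))) := by
  have h1 := (hasSum_geometric_of_lt_one hγ hγ1).mul_left (S.γ ^ N * S.γ)
  rw [div_eq_mul_inv, ← mul_assoc]
  refine h1.congr_fun ?_
  intro i
  ring

lemma sum_geometric_shift_le (hγ : 0 ≤ S.γ) (hγ1 : S.γ < 1) (N j : ℕ) :
    ∑ i ∈ Finset.range j, S.γ ^ (N + i + 1) ≤ S.γ ^ N * (S.γ / (1 - S.γ)) :=
  sum_le_hasSum _ (fun _ _ => pow_nonneg hγ _) (hasSum_geometric_shift hγ hγ1 N)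

/-- The Lyapunov inequality telescopes with a geometrically discounted noise input, so the
discounted squared norms are summable and tend to zero. Without the discount the moments may
diverge. -/
lemma DiscountStable.tendsto_traj [IsProbabilityMeasure P] (h : IsNoise P S.W d w)
    (hγ : 0 ≤ S.γ) (hγ1 : S.γ < 1) {K : Matrix (Fin m) (Fin n) ℝ} (hK : S.DiscountStable K)
    {ξ : Ω → Fin n → ℝ} (hξ : IsInitial P d w ξ) (G : Matrix (Fin n) (Fin n) ℝ) :
    Tendsto (fun k => S.γ ^ k *
      ∫ ω, qform G (S.traj d w (gainPolicy fun _ => K) ξ k ω) ∂P) atTop (𝓝 0) := by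
  obtain ⟨Y, hY, hYK⟩ := hK
  set x := S.traj d w (gainPolicy fun _ => K) ξ with hx
  have hL2 : ∀ k, MemLp (x k) 2 P := memLp_traj h _ hξ
  have hsq : ∀ k, Integrable (fun ω => x k ω ⬝ᵥ x k ω) P := fun k => by
    simpa only [qform_one] using integrable_qform 1 (hL2 k)
  set b : ℕ → ℝ := fun k => S.γ ^ k * ∫ ω, qform Y (x k ω) ∂P with hb
  set e : ℕ → ℝ := fun k => S.γ ^ k * ∫ ω, x k ω ⬝ᵥ x k ω ∂P with he
  have he0 : ∀ k, 0 ≤ e k := fun k =>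
    mul_nonneg (pow_nonneg hγ k) (integral_nonneg fun ω => dotProduct_self_nonneg' _)
  have hb0 : ∀ k, 0 ≤ b k := fun k =>
    mul_nonneg (pow_nonneg hγ k) (integral_nonneg fun ω => hY _)
  have hstep : ∀ k, b (k + 1) + e k ≤ b k + (Y * S.W).trace * S.γ ^ (0 + k + 1) := by
    intro k
    have h1 := integral_qform_traj_succ h (fun _ => K) hξ Y k
    have h2 : ∫ ω, (x k ω ⬝ᵥ x k ω + S.γ * qform (S.dualMap K Y) (x k ω)) ∂P
        ≤ ∫ ω, qform Y (x k ω) ∂P :=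
      integral_mono ((hsq k).add ((integrable_qform _ (hL2 k)).const_mul _))
        (integrable_qform _ (hL2 k)) fun ω => hYK _
    rw [integral_add (hsq k) ((integrable_qform _ (hL2 k)).const_mul _),
      integral_const_mul] at h2
    have h3 := mul_le_mul_of_nonneg_left h2 (pow_nonneg hγ k)
    simp only [hb, he, hx] at h3 ⊢
    rw [h1, zero_add, pow_succ]
    linarith
  have hsum : ∀ N, b N + ∑ k ∈ Finset.range N, e k
      ≤ b 0 + (Y * S.W).trace * ∑ k ∈ Finset.range N, S.γ ^ (0 + k + 1) := by
    intro N
    induction N with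
    | zero => simp
    | succ N ih =>
      rw [Finset.sum_range_succ, Finset.sum_range_succ]
      linarith [hstep N]
  -- `Y` need not be symmetric, so the trace is bounded by its absolute value rather than by a sign.
  have hbound : ∀ N, ∑ k ∈ Finset.range N, e k
      ≤ b 0 + |(Y * S.W).trace| * (S.γ ^ 0 * (S.γ / (1 - S.γ))) := by
    intro N
    have h1 := hsum N
    have h2 := sum_geometric_shift_le hγ hγ1 0 N
    have h3 : 0 ≤ ∑ k ∈ Finset.range N, S.γ ^ (0 + k + 1) :=
      Finset.sum_nonneg fun _ _ => pow_nonneg hγ _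
    have h4 := mul_le_mul_of_nonneg_right (le_abs_self (Y * S.W).trace) h3
    have h5 := mul_le_mul_of_nonneg_left h2 (abs_nonneg (Y * S.W).trace)
    linarith [hb0 N]
  have hlim := (summable_of_sum_range_le he0 hbound).tendsto_atTop_zero
  obtain ⟨c, -, hc⟩ := exists_abs_qform_le G
  refine squeeze_zero_norm (a := fun k => c * e k) (fun k => ?_)
    (by simpa using hlim.const_mul c)
  rw [norm_mul, Real.norm_of_nonneg (pow_nonneg hγ k)]
  have h1 : ‖∫ ω, qform G (x k ω) ∂P‖ ≤ ∫ ω, c * (x k ω ⬝ᵥ x k ω) ∂P :=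
    norm_integral_le_of_norm_le ((hsq k).const_mul c) (ae_of_all _ fun ω => hc _)
  rw [integral_const_mul] at h1
  have h2 := mul_le_mul_of_nonneg_left h1 (pow_nonneg hγ k)
  simp only [he]
  linarith

/-- The cost of a discounted-stable gain. -/
lemma DiscountStable.V_eq [IsProbabilityMeasure P] (h : IsNoise P S.W d w)
    (hQ : S.Q.PosSemidef) (hR : S.R.PosDef) (hγ : 0 ≤ S.γ) (hγ1 : S.γ < 1)
    {K : Matrix (Fin m) (Fin n) ℝ} (hK : S.DiscountStable K) {G : Matrix (Fin n) (Fin n) ℝ}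
    (hG : S.IsCostKernel K G) {ξ : Ω → Fin n → ℝ} (hξ : IsInitial P d w ξ) :
    S.V P d w (linearPolicy K) ξ = ENNReal.ofReal
      (∫ ω, qform G (ξ ω) ∂P + S.γ / (1 - S.γ) * (G * S.W).trace) := by
  have hnn : ∀ i, 0 ≤ S.γ ^ i * S.expectedCost P d w (fun _ => K) ξ i := fun i =>
    mul_nonneg (pow_nonneg hγ i) (expectedCost_nonneg hQ hR _ _ _)
  have hsum : HasSum (fun i => S.γ ^ i * S.expectedCost P d w (fun _ => K) ξ i)
      (∫ ω, qform G (ξ ω) ∂P + S.γ / (1 - S.γ) * (G * S.W).trace) := by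
    rw [hasSum_iff_tendsto_nat_of_nonneg hnn]
    have h1 := ((hK.tendsto_traj h hγ hγ1 hξ G).const_sub (∫ ω, qform G (ξ ω) ∂P)).add
      ((hasSum_geometric_shift hγ hγ1 0).tendsto_sum_nat.const_mul (G * S.W).trace)
    have h2 : ∫ ω, qform G (ξ ω) ∂P - 0 + (G * S.W).trace * (S.γ ^ 0 * (S.γ / (1 - S.γ)))
        = ∫ ω, qform G (ξ ω) ∂P + S.γ / (1 - S.γ) * (G * S.W).trace := by
      ring
    rw [h2] at h1
    refine h1.congr fun j => ?_
    have h3 := sum_expectedCost h (fun _ => K) hξ hG 0 j fun _ _ => rfl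
    simp only [zero_add, pow_zero, one_mul] at h3 ⊢
    exact h3.symm
  rw [← hsum.tsum_eq, ENNReal.ofReal_tsum_of_nonneg hnn hsum.summable]
  exact V_gainPolicy h hQ hR hγ (fun _ => K) hξ

/-- A positive semidefinite cost kernel bounds the cost of its gain, stable or not. -/
lemma V_le_of_isCostKernel [IsProbabilityMeasure P] (h : IsNoise P S.W d w)
    (hQ : S.Q.PosSemidef) (hR : S.R.PosDef) (hγ : 0 ≤ S.γ) (hγ1 : S.γ < 1)
    {K : Matrix (Fin m) (Fin n) ℝ} {G : Matrix (Fin n) (Fin n) ℝ}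
    (hG : S.IsCostKernel K G) (hGpsd : G.PosSemidef) {ξ : Ω → Fin n → ℝ}
    (hξ : IsInitial P d w ξ) :
    S.V P d w (linearPolicy K) ξ ≤ ENNReal.ofReal
      (∫ ω, qform G (ξ ω) ∂P + S.γ / (1 - S.γ) * (G * S.W).trace) := by
  have hnn : ∀ i, 0 ≤ S.γ ^ i * S.expectedCost P d w (fun _ => K) ξ i := fun i =>
    mul_nonneg (pow_nonneg hγ i) (expectedCost_nonneg hQ hR _ _ _)
  refine (V_gainPolicy h hQ hR hγ (fun _ => K) hξ).trans_le
    (ENNReal.tsum_le_of_sum_range_le fun j => ?_)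
  rw [← ENNReal.ofReal_sum_of_nonneg fun i _ => hnn i]
  refine ENNReal.ofReal_le_ofReal ?_
  have h3 := sum_expectedCost h (fun _ => K) hξ hG 0 j fun _ _ => rfl
  have h4 : 0 ≤ S.γ ^ (0 + j) *
      ∫ ω, qform G (S.traj d w (gainPolicy fun _ => K) ξ (0 + j) ω) ∂P :=
    mul_nonneg (pow_nonneg hγ _) (integral_nonneg fun ω => (posSemidef_iff_qform.1 hGpsd).2 _)
  have h5 := mul_le_mul_of_nonneg_left (sum_geometric_shift_le hγ hγ1 0 j)
    (trace_mul_noise_nonneg h hGpsd)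
  simp only [zero_add, pow_zero, one_mul, traj] at h3 h4 h5
  linarith

/-- Using a discounted-stable gain for a long time and an admissible one afterwards is an
admissible policy, with nearly the cost of the first gain. -/
lemma DiscountStable.Vstar_le [IsProbabilityMeasure P] (h : IsNoise P S.W d w)
    (hQ : S.Q.PosSemidef) (hR : S.R.PosDef) (hγ : 0 ≤ S.γ) (hγ1 : S.γ < 1)
    {K₀ : Matrix (Fin m) (Fin n) ℝ} (hK₀ : S.MeanSquareStationary K₀)
    {K : Matrix (Fin m) (Fin n) ℝ} (hK : S.DiscountStable K) {G : Matrix (Fin n) (Fin n) ℝ}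
    (hG : S.IsCostKernel K G) {ξ : Ω → Fin n → ℝ} (hξ : IsInitial P d w ξ) :
    S.Vstar P d w ξ ≤ ENNReal.ofReal
      (∫ ω, qform G (ξ ω) ∂P + S.γ / (1 - S.γ) * (G * S.W).trace) := by
  have hK₀s := hK₀.discountStable hγ1
  obtain ⟨G₀, hG₀⟩ : ∃ G₀, S.IsCostKernel K₀ G₀ := hK₀s.exists_lyap S hγ
    (posSemidef_iff_qform.1 hQ).1 (posSemidef_iff_qform.1 hR.posSemidef).1
  have hGpsd := hG.posSemidef hQ hR hγ hK
  have hG₀psd := hG₀.posSemidef hQ hR hγ hK₀s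
  set x := S.traj d w (gainPolicy fun _ => K) ξ with hx
  set τ := S.γ / (1 - S.γ) with hτ
  -- The first `N` costs are bounded by the value of `K`. The remaining ones are bounded by the
  -- value of `K₀` from the state at time `N`, discounted by `γ ^ N`.
  have hbound : ∀ N : ℕ, S.Vstar P d w ξ ≤ ENNReal.ofReal
      (∫ ω, qform G (ξ ω) ∂P + τ * (G * S.W).trace
        + (S.γ ^ N * ∫ ω, qform G₀ (x N ω) ∂P + (G₀ * S.W).trace * (S.γ ^ N * τ))) := by
    intro N
    set L : ℕ → Matrix (Fin m) (Fin n) ℝ := fun k => if k < N then K else K₀ with hL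
    have hadm : S.Admissible P d w (gainPolicy L) :=
      admissible_gainPolicy h hK₀ L (N := N) fun k hk => if_neg (by omega)
    refine (iInf₂_le (gainPolicy L) hadm).trans ?_
    have hnn : ∀ i, 0 ≤ S.γ ^ i * S.expectedCost P d w L ξ i := fun i =>
      mul_nonneg (pow_nonneg hγ i) (expectedCost_nonneg hQ hR _ _ _)
    rw [V_gainPolicy h hQ hR hγ L hξ]
    refine ENNReal.tsum_le_of_sum_range_le fun j => ?_
    rw [← ENNReal.ofReal_sum_of_nonneg fun i _ => hnn i]
    refine ENNReal.ofReal_le_ofReal ?_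
    -- Extending the partial sum to `N + j` terms lets it be split at the switching time for every
    -- `j`.
    have h0 : ∑ i ∈ Finset.range j, S.γ ^ i * S.expectedCost P d w L ξ i
        ≤ ∑ i ∈ Finset.range (N + j), S.γ ^ i * S.expectedCost P d w L ξ i :=
      Finset.sum_le_sum_of_subset_of_nonneg (Finset.range_mono (by omega)) fun i _ _ => hnn i
    refine h0.trans ?_
    rw [Finset.sum_range_add]
    have h1 := sum_expectedCost h L hξ hG 0 N fun i hi => if_pos (by omega)
    have h2 := sum_expectedCost h L hξ hG₀ N j fun i _ => if_neg (by omega)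
    have h3 : S.traj d w (gainPolicy L) ξ N = x N := traj_congr ξ fun k hk => by
      funext y
      simp only [gainPolicy, hL, if_pos hk]
    have h4 : ∀ (G : Matrix (Fin n) (Fin n) ℝ) (k : ℕ), G.PosSemidef → 0 ≤ S.γ ^ k *
        ∫ ω, qform G (S.traj d w (gainPolicy L) ξ k ω) ∂P := fun G k hG =>
      mul_nonneg (pow_nonneg hγ _) (integral_nonneg fun ω => (posSemidef_iff_qform.1 hG).2 _)
    have h5 := h4 G (0 + N) hGpsd
    have h6 := h4 G₀ (N + j) hG₀psd
    have h7 := mul_le_mul_of_nonneg_left (sum_geometric_shift_le hγ hγ1 0 N)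
      (trace_mul_noise_nonneg h hGpsd)
    have h8 := mul_le_mul_of_nonneg_left (sum_geometric_shift_le hγ hγ1 N j)
      (trace_mul_noise_nonneg h hG₀psd)
    rw [h3] at h2
    rw [← hτ] at h7 h8
    simp only [zero_add, pow_zero, one_mul, traj] at h1 h5 h7
    linarith
  have hpow : Tendsto (fun N : ℕ => S.γ ^ N) atTop (𝓝 0) :=
    tendsto_pow_atTop_nhds_zero_of_lt_one hγ hγ1
  have hlim := (((hK.tendsto_traj h hγ hγ1 hξ G₀).add
    ((hpow.mul_const τ).const_mul (G₀ * S.W).trace))).const_add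
      (∫ ω, qform G (ξ ω) ∂P + τ * (G * S.W).trace)
  simp only [zero_mul, mul_zero, add_zero] at hlim
  exact ge_of_tendsto' (ENNReal.tendsto_ofReal hlim) hbound

/-- Admissibility asks only for square-integrable states. For the inputs this follows from finite
cost, since `R` is positive definite. -/
lemma memLp_of_lintegral_cost_ne_top (hQ : S.Q.PosSemidef) (hR : S.R.PosDef)
    {ξ : Ω → Fin n → ℝ} {η : Ω → Fin m → ℝ} (hη : Measurable η)
    (hfin : ∫⁻ ω, ENNReal.ofReal (S.cost (ξ ω) (η ω)) ∂P ≠ ∞) : MemLp η 2 P := by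
  obtain ⟨r, hr, hle⟩ := hR.exists_le_qform
  refine MemLp.of_eval fun i => ?_
  have hm : Measurable fun ω => η ω i := (measurable_pi_apply i).comp hη
  refine (memLp_two_iff_integrable_sq hm.aestronglyMeasurable).2 ?_
  have hb : ∀ ω, r * η ω i ^ 2 ≤ S.cost (ξ ω) (η ω) := fun ω => by
    have h1 := mul_le_mul_of_nonneg_left (sq_le_dotProduct_self (η ω) i) hr.le
    have h2 := (posSemidef_iff_qform.1 hQ).2 (ξ ω)
    rw [cost_eq, pow_two]
    linarith [hle (η ω)]
  have hi : Integrable (fun ω => r * η ω i ^ 2) P := by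
    refine ⟨((hm.pow_const 2).const_mul r).aestronglyMeasurable, ?_⟩
    rw [hasFiniteIntegral_iff_ofReal (ae_of_all _ fun ω => by positivity)]
    exact (lintegral_mono fun ω => ENNReal.ofReal_le_ofReal (hb ω)).trans_lt hfin.lt_top
  simpa [hr.ne'] using hi.const_mul r⁻¹

/-- A kernel below its Bellman update bounds the cost of every admissible policy from below. -/
lemma le_V_of_admissible [IsProbabilityMeasure P] (h : IsNoise P S.W d w)
    (hQ : S.Q.PosSemidef) (hR : S.R.PosDef) (hγ : 0 ≤ S.γ) (hγ1 : S.γ < 1)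
    {G : Matrix (Fin n) (Fin n) ℝ} (hle : ∀ x u, qform G x ≤ S.bellman G x u)
    {π : ℕ → (Fin n → ℝ) → (Fin m → ℝ)} (hπ : S.Admissible P d w π) {ξ : Ω → Fin n → ℝ}
    (hξ : IsInitial P d w ξ) :
    ENNReal.ofReal (∫ ω, qform G (ξ ω) ∂P + S.γ / (1 - S.γ) * (G * S.W).trace)
      ≤ S.V P d w π ξ := by
  obtain ⟨hπm, X, -, hX⟩ := hπ
  obtain ⟨hL2, hlim⟩ := hX ξ hξ
  by_cases htop : S.V P d w π ξ = ∞
  · rw [htop]; exact le_top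
  set x := S.traj d w π ξ with hx
  have hxm : ∀ k, Measurable (x k) := measurable_traj h hπm hξ.1
  rw [V_eq_tsum h hπm hξ.1] at htop ⊢
  set t : ℕ → ℝ≥0∞ := fun i => ∫⁻ ω, ENNReal.ofReal
      (S.γ ^ i * S.cost (x i ω) (π i (x i ω))) ∂P with ht
  have htk : ∀ k, t k ≠ ∞ := fun k => ENNReal.ne_top_of_tsum_ne_top htop k
  have hstep : ∀ k, S.γ ^ k * ∫ ω, qform G (x k ω) ∂P + (G * S.W).trace * S.γ ^ (0 + k + 1)
      ≤ (t k).toReal + S.γ ^ (k + 1) * ∫ ω, qform G (x (k + 1) ω) ∂P := by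
    intro k
    -- If `γ ^ k = 0`, finiteness of the weighted cost says nothing about the input, but then every
    -- quadratic and noise term vanishes.
    rcases (pow_nonneg hγ k).eq_or_lt with h0 | h0
    · rw [zero_add, pow_succ, ← h0]
      simp
    have htk' : t k = ENNReal.ofReal (S.γ ^ k) *
        ∫⁻ ω, ENNReal.ofReal (S.cost (x k ω) (π k (x k ω))) ∂P := by
      have hcm : Measurable fun ω => S.cost (x k ω) (π k (x k ω)) :=
        measurable_cost (hxm k) ((hπm k).comp (hxm k))
      rw [← lintegral_const_mul _ hcm.ennreal_ofReal]
      exact lintegral_congr fun ω => ENNReal.ofReal_mul (pow_nonneg hγ k)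
    have hu : MemLp (fun ω => π k (x k ω)) 2 P := by
      refine memLp_of_lintegral_cost_ne_top hQ hR (ξ := x k) ((hπm k).comp (hxm k)) fun hinf => ?_
      refine htk k ?_
      rw [htk', hinf, ENNReal.mul_top (by simpa using h0)]
    have hc := integrable_cost (S := S) (hL2 k) hu
    have htr : (t k).toReal = S.γ ^ k * ∫ ω, S.cost (x k ω) (π k (x k ω)) ∂P := by
      rw [htk', ← ofReal_integral_eq_lintegral_ofReal hc
        (ae_of_all _ fun ω => cost_nonneg hQ hR _ _), ENNReal.toReal_mul,
        ENNReal.toReal_ofReal h0.le,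
        ENNReal.toReal_ofReal (integral_nonneg fun ω => cost_nonneg hQ hR _ _)]
    have h1 := integral_cost_add h k (hL2 k) hu (indepFun_traj_input h hπm hξ k) G
    have h2 : ∫ ω, qform G (x k ω) ∂P ≤ ∫ ω, S.bellman G (x k ω) (π k (x k ω)) ∂P :=
      integral_mono (integrable_qform G (hL2 k)) (integrable_bellman G (hL2 k) hu)
        fun ω => hle _ _
    have h3 : ∫ ω, S.cost (x k ω) (π k (x k ω)) ∂P + S.γ * ∫ ω, qform G (x (k + 1) ω) ∂P
        = ∫ ω, S.bellman G (x k ω) (π k (x k ω)) ∂P + S.γ * (G * S.W).trace := h1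
    rw [htr, zero_add, pow_succ]
    have h4 := mul_le_mul_of_nonneg_left (h2.trans_eq (eq_sub_of_add_eq h3.symm)) h0.le
    linarith
  have hsum : ∀ N, ∫ ω, qform G (ξ ω) ∂P
      + (G * S.W).trace * ∑ k ∈ Finset.range N, S.γ ^ (0 + k + 1)
      ≤ ∑ k ∈ Finset.range N, (t k).toReal + S.γ ^ N * ∫ ω, qform G (x N ω) ∂P := by
    intro N
    induction N with
    | zero => simp [hx, traj]
    | succ N ih =>
      rw [Finset.sum_range_succ, Finset.sum_range_succ]
      linarith [hstep N]
  have hq : Tendsto (fun k => ∫ ω, qform G (x k ω) ∂P) atTop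
      (𝓝 (∑ i, ∑ j, G i j * X i j)) := by
    simp only [fun k => integral_qform G (hL2 k)]
    exact tendsto_finsetSum _ fun i _ => tendsto_finsetSum _ fun j _ =>
      (tendsto_pi_nhds.1 (tendsto_pi_nhds.1 hlim i) j).const_mul _
  -- Admissibility enters here: convergent second moments make the discounted terminal term vanish,
  -- whatever the sign of `G`.
  have htail := (tendsto_pow_atTop_nhds_zero_of_lt_one hγ hγ1).mul hq
  rw [zero_mul] at htail
  have hts : HasSum (fun k => (t k).toReal) (∑' k, t k).toReal := by
    rw [ENNReal.tsum_toReal_eq htk]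
    exact (ENNReal.summable_toReal htop).hasSum
  have hfin := le_of_tendsto_of_tendsto'
    (((hasSum_geometric_shift hγ hγ1 0).tendsto_sum_nat.const_mul (G * S.W).trace).const_add
      (∫ ω, qform G (ξ ω) ∂P)) (hts.tendsto_sum_nat.add htail) hsum
  refine ENNReal.ofReal_le_of_le_toReal (le_of_eq_of_le ?_ (hfin.trans_eq (add_zero _)))
  ring

end Cost

/-! ### The model-free iteration and its Q-functions. -/

section ModelFree

variable {n m : ℕ} {S : LQRData n m} {Ω : Type*} [MeasurableSpace Ω] {P : Measure Ω}
  {d : ℕ → Ω → ℝ} {w : ℕ → Ω → Fin n → ℝ}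

lemma eq_of_quad_eq {H H' : Matrix (Fin n ⊕ Fin m) (Fin n ⊕ Fin m) ℝ} (hH : H.IsSymm)
    (hH' : H'.IsSymm) (h : ∀ x u, quad H x u = quad H' x u) : H = H' := by
  refine eq_of_qform_eq hH hH' fun z => ?_
  rw [← Sum.elim_comp_inl_inr z]
  exact h _ _

/-- The Bellman equation of the Q-function of `L` determines its kernel up to its compression. -/
lemma policyEvaluation_iff [IsProbabilityMeasure P] (h : IsNoise P S.W d w)
    (hQ : S.Q.IsSymm) (hR : S.R.IsSymm) (L : Matrix (Fin m) (Fin n) ℝ)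
    (H : Matrix (Fin n ⊕ Fin m) (Fin n ⊕ Fin m) ℝ) :
    S.PolicyEvaluation P d w L H ↔ H.IsSymm ∧ H = S.kernelOf (compress L H) := by
  have hstep : ∀ (k : ℕ) (ξ : Ω → Fin n → ℝ) (η : Ω → Fin m → ℝ), MemLp ξ 2 P → MemLp η 2 P →
      IndepFun (fun ω => (ξ ω, η ω)) (fun ω => (d k ω, w k ω)) P →
      ∫ ω, S.cost (ξ ω) (η ω) ∂P
        + S.γ * ∫ ω, quad H (S.step (ξ ω) (η ω) (d k ω) (w k ω))
          (L *ᵥ S.step (ξ ω) (η ω) (d k ω) (w k ω)) ∂P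
        - S.γ * S.noiseTrace H L = ∫ ω, S.bellman (compress L H) (ξ ω) (η ω) ∂P := by
    intro k ξ η hξ hη hind
    have h1 := integral_cost_add h k hξ hη hind (compress L H)
    simp only [← qform_compress, noiseTrace_eq]
    linarith
  constructor
  · rintro ⟨hs, heq⟩
    refine ⟨hs, eq_of_quad_eq hs (kernelOf_isSymm S hQ hR (compress_isSymm L hs)) fun x u => ?_⟩
    -- Constant pairs are independent of the noise, so the averaged Bellman equation becomes
    -- pointwise in `(x, u)`.
    have hind : IndepFun (fun _ : Ω => (x, u)) (fun ω => (d 0 ω, w 0 ω)) P :=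
      indepFun_const_left _ _
    have h1 := heq 0 (fun _ => x) (fun _ => u) measurable_const measurable_const (memLp_const x)
      (memLp_const u) hind
    rw [hstep 0 (fun _ => x) (fun _ => u) (memLp_const x) (memLp_const u) hind] at h1
    rw [quad_kernelOf]
    simpa using h1
  · rintro ⟨hs, heq⟩
    refine ⟨hs, fun k ξ η _ _ hξ hη hind => ?_⟩
    rw [hstep k ξ η hξ hη hind]
    refine integral_congr_ae (ae_of_all _ fun ω => ?_)
    change quad H (ξ ω) (η ω) = _
    conv_lhs => rw [heq]
    rw [quad_kernelOf]

lemma IsCostKernel.compress_kernelOf {L : Matrix (Fin m) (Fin n) ℝ}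
    {G : Matrix (Fin n) (Fin n) ℝ} (hG : S.IsCostKernel L G) (hQ : S.Q.IsSymm)
    (hR : S.R.IsSymm) : compress L (S.kernelOf G) = G := by
  refine eq_of_qform_eq (compress_isSymm L (S.kernelOf_isSymm hQ hR hG.1)) hG.1 fun x => ?_
  rw [qform_compress, quad_kernelOf, hG.qform_eq x]

lemma IsCostKernel.noiseTrace_kernelOf {L : Matrix (Fin m) (Fin n) ℝ}
    {G : Matrix (Fin n) (Fin n) ℝ} (hG : S.IsCostKernel L G) (hQ : S.Q.IsSymm)
    (hR : S.R.IsSymm) : S.noiseTrace (S.kernelOf G) L = (G * S.W).trace := by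
  rw [noiseTrace_eq, hG.compress_kernelOf hQ hR]

/-- Restricting the kernel equation to `u = L x` gives the Lyapunov equation for `compress L H`. Its
unique symmetric solution determines `H` completely. -/
lemma DiscountStable.policyEvaluation_iff_eq [IsProbabilityMeasure P] (h : IsNoise P S.W d w)
    (hQ : S.Q.IsSymm) (hR : S.R.IsSymm) (hγ : 0 ≤ S.γ) {L : Matrix (Fin m) (Fin n) ℝ}
    (hL : S.DiscountStable L) {G : Matrix (Fin n) (Fin n) ℝ} (hG : S.IsCostKernel L G)
    (H : Matrix (Fin n ⊕ Fin m) (Fin n ⊕ Fin m) ℝ) :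
    S.PolicyEvaluation P d w L H ↔ H = S.kernelOf G := by
  rw [policyEvaluation_iff h hQ hR]
  constructor
  · rintro ⟨hs, heq⟩
    have hc : (compress L H).IsSymm := compress_isSymm L hs
    have hk : compress L H = S.lyap L (compress L H) :=
      eq_of_qform_eq hc (S.lyap_isSymm hQ hR L hc) fun x => by
        rw [qform_lyap, ← quad_kernelOf, ← heq, qform_compress]
    rw [heq, hL.eq_of_lyap S hγ hc hG.1 hk hG.2]
  · rintro rfl
    exact ⟨S.kernelOf_isSymm hQ hR hG.1, by rw [hG.compress_kernelOf hQ hR]⟩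

variable (S) in
open Classical in
/-- The cost kernel of a gain (zero if there is none). -/
def costKernel (L : Matrix (Fin m) (Fin n) ℝ) : Matrix (Fin n) (Fin n) ℝ :=
  if h : ∃ G, S.IsCostKernel L G then h.choose else 0

lemma DiscountStable.isCostKernel {L : Matrix (Fin m) (Fin n) ℝ} (hL : S.DiscountStable L)
    (hγ : 0 ≤ S.γ) (hQ : S.Q.IsSymm) (hR : S.R.IsSymm) : S.IsCostKernel L (S.costKernel L) := by
  have h : ∃ G, S.IsCostKernel L G := hL.exists_lyap S hγ hQ hR
  rw [costKernel, dif_pos h]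
  exact h.choose_spec

variable (S) in
/-- The gains of exact policy iteration. -/
def gainSeq (L₀ : Matrix (Fin m) (Fin n) ℝ) : ℕ → Matrix (Fin m) (Fin n) ℝ
  | 0 => L₀
  | i + 1 => S.gainOf (S.costKernel (gainSeq L₀ i))

lemma DiscountStable.gainSeq {L₀ : Matrix (Fin m) (Fin n) ℝ} (hL₀ : S.DiscountStable L₀)
    (hQ : S.Q.PosSemidef) (hR : S.R.PosDef) (hγ : 0 ≤ S.γ) (hγ1 : S.γ < 1) (i : ℕ) :
    S.DiscountStable (S.gainSeq L₀ i) := by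
  induction i with
  | zero => exact hL₀
  | succ i ih =>
    exact ih.gainOf (ih.isCostKernel hγ (posSemidef_iff_qform.1 hQ).1
      (posSemidef_iff_qform.1 hR.posSemidef).1) hQ hR hγ hγ1

lemma DiscountStable.isKernelIteration {L₀ : Matrix (Fin m) (Fin n) ℝ}
    (hL₀ : S.DiscountStable L₀) (hQ : S.Q.PosSemidef) (hR : S.R.PosDef) (hγ : 0 ≤ S.γ)
    (hγ1 : S.γ < 1) :
    S.IsKernelIteration (S.gainSeq L₀) fun i => S.costKernel (S.gainSeq L₀ i) where
  kernel i := (hL₀.gainSeq hQ hR hγ hγ1 i).isCostKernel hγ (posSemidef_iff_qform.1 hQ).1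
    (posSemidef_iff_qform.1 hR.posSemidef).1
  improve _ := rfl

/-- The model-free iteration is exact policy iteration. -/
lemma DiscountStable.isModelFreePI_iff [IsProbabilityMeasure P] (h : IsNoise P S.W d w)
    {L₀ : Matrix (Fin m) (Fin n) ℝ}
    (hL₀ : S.DiscountStable L₀) (hQ : S.Q.PosSemidef) (hR : S.R.PosDef) (hγ : 0 ≤ S.γ)
    (hγ1 : S.γ < 1) (L : ℕ → Matrix (Fin m) (Fin n) ℝ)
    (H : ℕ → Matrix (Fin n ⊕ Fin m) (Fin n ⊕ Fin m) ℝ) :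
    S.IsModelFreePI P d w L₀ L H ↔ L = S.gainSeq L₀ ∧
      H = fun i => S.kernelOf (S.costKernel (S.gainSeq L₀ i)) := by
  have heval := fun i => (hL₀.gainSeq hQ hR hγ hγ1 i).policyEvaluation_iff_eq h
    (posSemidef_iff_qform.1 hQ).1 (posSemidef_iff_qform.1 hR.posSemidef).1 hγ
    ((hL₀.isKernelIteration hQ hR hγ hγ1).kernel i)
  constructor
  · intro hPI
    have hL : ∀ i, L i = S.gainSeq L₀ i := by
      intro i
      induction i with
      | zero => exact hPI.init
      | succ i ih =>
        have hH := hPI.evaluation i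
        rw [ih, heval] at hH
        rw [hPI.improvement, hH]
        simp [kernelOf, LQRData.gainSeq, LQRData.gainOf]
    refine ⟨funext hL, funext fun i => ?_⟩
    rw [← heval, ← hL]
    exact hPI.evaluation i
  · rintro ⟨rfl, rfl⟩
    refine ⟨rfl, fun i => (heval i _).2 rfl, fun i => ?_⟩
    simp [kernelOf, LQRData.gainSeq, LQRData.gainOf]

/-- One step with an arbitrary input, followed by a quadratic cost-to-go. -/
lemma lintegral_cost_add_eq [IsProbabilityMeasure P] (h : IsNoise P S.W d w)
    (hQ : S.Q.PosSemidef) (hR : S.R.PosDef) (hγ : 0 ≤ S.γ) (hγ1 : S.γ < 1)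
    {G : Matrix (Fin n) (Fin n) ℝ} (hG : G.PosSemidef) {ξ : Ω → Fin n → ℝ} {η : Ω → Fin m → ℝ}
    (hz : IsInitial P d w (fun ω => (ξ ω, η ω))) :
    ∫⁻ ω, ENNReal.ofReal (S.cost (ξ ω) (η ω)) ∂P + ENNReal.ofReal S.γ * ENNReal.ofReal
        (∫ ω, qform G (S.step (ξ ω) (η ω) (d 0 ω) (w 0 ω)) ∂P
          + S.γ / (1 - S.γ) * (G * S.W).trace)
      = ENNReal.ofReal (∫ ω, quad (S.kernelOf G) (ξ ω) (η ω) ∂P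
          + S.γ / (1 - S.γ) * (G * S.W).trace) := by
  obtain ⟨hξ, hη⟩ := memLp_prod_iff.1 hz.2.1
  have hind : IndepFun (fun ω => (ξ ω, η ω)) (fun ω => (d 0 ω, w 0 ω)) P :=
    hz.2.2.comp (φ := id) (ψ := fun g : ℕ → ℝ × (Fin n → ℝ) => g 0) measurable_id (by fun_prop)
  have h1 := integral_cost_add h 0 hξ hη hind G
  have h2 : 0 ≤ ∫ ω, qform G (S.step (ξ ω) (η ω) (d 0 ω) (w 0 ω)) ∂P :=
    integral_nonneg fun ω => (posSemidef_iff_qform.1 hG).2 _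
  have h3 : 0 ≤ S.γ / (1 - S.γ) * (G * S.W).trace :=
    mul_nonneg (div_nonneg hγ (by linarith)) (trace_mul_noise_nonneg h hG)
  -- The noise factor is the fixed point of `τ ↦ γ + γ τ`: one more step of noise, then the
  -- discounted rest.
  have h4 : S.γ + S.γ * (S.γ / (1 - S.γ)) = S.γ / (1 - S.γ) := by
    have : 1 - S.γ ≠ 0 := by linarith
    field_simp
    ring
  rw [← ofReal_integral_eq_lintegral_ofReal (integrable_cost hξ hη)
    (ae_of_all _ fun ω => cost_nonneg hQ hR _ _), ← ENNReal.ofReal_mul hγ,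
    ← ENNReal.ofReal_add (integral_nonneg fun ω => cost_nonneg hQ hR _ _)
      (mul_nonneg hγ (add_nonneg h2 h3))]
  simp only [quad_kernelOf]
  congr 1
  linear_combination h1 + (G * S.W).trace * h4

lemma DiscountStable.Qfun_eq [IsProbabilityMeasure P] (h : IsNoise P S.W d w)
    (hQ : S.Q.PosSemidef) (hR : S.R.PosDef) (hγ : 0 ≤ S.γ) (hγ1 : S.γ < 1)
    {L : Matrix (Fin m) (Fin n) ℝ} (hL : S.DiscountStable L) {G : Matrix (Fin n) (Fin n) ℝ}
    (hG : S.IsCostKernel L G) {ξ : Ω → Fin n → ℝ} {η : Ω → Fin m → ℝ}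
    (hz : IsInitial P d w (fun ω => (ξ ω, η ω))) :
    S.Qfun P d w L ξ η = ENNReal.ofReal (∫ ω, quad (S.kernelOf G) (ξ ω) (η ω) ∂P
      + S.γ / (1 - S.γ) * (G * S.W).trace) := by
  rw [Qfun, hL.V_eq h.shift hQ hR hγ hγ1 hG (isInitial_step h hz)]
  exact lintegral_cost_add_eq h hQ hR hγ hγ1 (hG.posSemidef hQ hR hγ hL) hz

lemma tendsto_integral_quad {H : ℕ → Matrix (Fin n ⊕ Fin m) (Fin n ⊕ Fin m) ℝ}
    {H' : Matrix (Fin n ⊕ Fin m) (Fin n ⊕ Fin m) ℝ} (hH : Tendsto H atTop (𝓝 H'))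
    {z : Ω → Fin n ⊕ Fin m → ℝ} (hz : MemLp z 2 P) :
    Tendsto (fun i => ∫ ω, qform (H i) (z ω) ∂P) atTop (𝓝 (∫ ω, qform H' (z ω) ∂P)) := by
  have hq : ∀ K : Matrix (Fin n ⊕ Fin m) (Fin n ⊕ Fin m) ℝ, ∫ ω, qform K (z ω) ∂P
      = ∑ a, ∑ b, K a b * ∫ ω, z ω a * z ω b ∂P := by
    intro K
    have hab : ∀ a b, Integrable (fun ω => K a b * (z ω a * z ω b)) P := fun a b =>
      (integrable_mul_of_memLp_two (memLp_apply hz a) (memLp_apply hz b)).const_mul _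
    simp only [qform_eq_sum]
    rw [integral_finsetSum _ fun a _ => integrable_finsetSum _ fun b _ => hab a b]
    refine Finset.sum_congr rfl fun a _ => ?_
    rw [integral_finsetSum _ fun b _ => hab a b]
    exact Finset.sum_congr rfl fun b _ => integral_const_mul _ _
  simp only [hq]
  exact tendsto_finsetSum _ fun a _ => tendsto_finsetSum _ fun b _ =>
    (tendsto_pi_nhds.1 (tendsto_pi_nhds.1 hH a) b).mul_const _

/-- The optimal cost is the quadratic cost of the limit of policy iteration. -/
lemma Vstar_eq [IsProbabilityMeasure P] (h : IsNoise P S.W d w)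
    (hQ : S.Q.PosSemidef) (hR : S.R.PosDef) (hγ : 0 ≤ S.γ) (hγ1 : S.γ < 1)
    {L₀ : Matrix (Fin m) (Fin n) ℝ} (hL₀ : S.MeanSquareStationary L₀)
    {G : Matrix (Fin n) (Fin n) ℝ} (hG : G.PosSemidef) (hsare : S.SARE G)
    (hlim : Tendsto (fun i => S.costKernel (S.gainSeq L₀ i)) atTop (𝓝 G))
    {ξ : Ω → Fin n → ℝ} (hξ : IsInitial P d w ξ) :
    S.Vstar P d w ξ = ENNReal.ofReal
      (∫ ω, qform G (ξ ω) ∂P + S.γ / (1 - S.γ) * (G * S.W).trace) := by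
  have hstab := hL₀.discountStable hγ1
  refine le_antisymm ?_ (le_iInf₂ fun π hπ => le_V_of_admissible h hQ hR hγ hγ1
    (qform_le_bellman_of_sare hQ hR hγ hG hsare) hπ hξ)
  -- The upper bound is taken along the iterates, whose gains are stable, because stability of the
  -- limit gain is unknown.
  have h1 : Tendsto (fun i => ∫ ω, qform (S.costKernel (S.gainSeq L₀ i)) (ξ ω) ∂P
      + S.γ / (1 - S.γ) * (S.costKernel (S.gainSeq L₀ i) * S.W).trace) atTop
      (𝓝 (∫ ω, qform G (ξ ω) ∂P + S.γ / (1 - S.γ) * (G * S.W).trace)) := by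
    simp only [integral_qform _ hξ.2.1, trace_mul_eq_sum h]
    have hc : Continuous fun G : Matrix (Fin n) (Fin n) ℝ =>
        ∑ i, ∑ j, G i j * secondMoment P ξ i j
          + S.γ / (1 - S.γ) * ∑ i, ∑ j, G i j * S.W i j := by
      fun_prop
    exact (hc.tendsto G).comp hlim
  exact ge_of_tendsto' (ENNReal.tendsto_ofReal h1) fun i =>
    (hstab.gainSeq hQ hR hγ hγ1 i).Vstar_le h hQ hR hγ hγ1 hL₀
      ((hstab.isKernelIteration hQ hR hγ hγ1).kernel i) hξ

end ModelFree

end LQRData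

end

/-! ### Assembly of the main theorem. -/

theorem theorem1 {n m : ℕ} (S : LQRData n m)
    (hQ : S.Q.PosSemidef) (hR : S.R.PosDef) (hW : S.W.PosSemidef)
    (hγ0 : 0 ≤ S.γ) (hγ1 : S.γ < 1)
    {Ω : Type*} [MeasurableSpace Ω] (P : Measure Ω) [IsProbabilityMeasure P]
    (d : ℕ → Ω → ℝ) (w : ℕ → Ω → Fin n → ℝ) (hnoise : IsNoise P S.W d w)
    (L0 : Matrix (Fin m) (Fin n) ℝ)
    (hL0 : S.Admissible P d w (LQRData.linearPolicy L0)) :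
    -- the algorithm produces exactly one pair of sequences
    (∃! LH : (ℕ → Matrix (Fin m) (Fin n) ℝ) × (ℕ → Matrix (Fin n ⊕ Fin m) (Fin n ⊕ Fin m) ℝ),
      S.IsModelFreePI P d w L0 LH.1 LH.2) ∧
    -- the optimal cost kernel, gain and Q-function
    ∃ Pstar : Matrix (Fin n) (Fin n) ℝ,
      S.IsGreatestSARE Pstar ∧
      (S.Q.PosDef → Pstar.PosDef ∧
        ∀ P' : Matrix (Fin n) (Fin n) ℝ, P'.PosSemidef → S.SARE P' → P' = Pstar) ∧
      (∀ ξ : Ω → Fin n → ℝ, IsInitial P d w ξ →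
        S.V P d w (LQRData.linearPolicy (S.gainOf Pstar)) ξ ≤ S.Vstar P d w ξ ∧
        S.Vstar P d w ξ = ENNReal.ofReal
          (∫ ω, ξ ω ⬝ᵥ (Pstar *ᵥ ξ ω) ∂P + S.γ / (1 - S.γ) * (Pstar * S.W).trace)) ∧
      (∀ (ξ : Ω → Fin n → ℝ) (η : Ω → Fin m → ℝ), IsInitial P d w (fun ω => (ξ ω, η ω)) →
        S.Qstar P d w ξ η = ENNReal.ofReal
          (∫ ω, LQRData.quad (S.kernelOf Pstar) (ξ ω) (η ω) ∂P
            + S.γ / (1 - S.γ) * S.noiseTrace (S.kernelOf Pstar) (S.gainOf Pstar))) ∧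
      -- convergence of the algorithm
      ∀ (L : ℕ → Matrix (Fin m) (Fin n) ℝ)
        (H : ℕ → Matrix (Fin n ⊕ Fin m) (Fin n ⊕ Fin m) ℝ), S.IsModelFreePI P d w L0 L H →
        (∀ i, (H i).toBlocks₂₂.PosDef) ∧
        Tendsto L atTop (𝓝 (S.gainOf Pstar)) ∧
        Tendsto H atTop (𝓝 (S.kernelOf Pstar)) ∧
        (∀ (k : ℕ) (x : Fin n → ℝ), Tendsto (fun i => LQRData.linearPolicy (L i) k x) atTop
          (𝓝 (LQRData.linearPolicy (S.gainOf Pstar) k x))) ∧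
        (∀ (ξ : Ω → Fin n → ℝ) (η : Ω → Fin m → ℝ), IsInitial P d w (fun ω => (ξ ω, η ω)) →
          (∀ i, S.Qfun P d w (L i) ξ η = ENNReal.ofReal
            (∫ ω, LQRData.quad (H i) (ξ ω) (η ω) ∂P
              + S.γ / (1 - S.γ) * S.noiseTrace (H i) (L i))) ∧
          Tendsto (fun i => S.Qfun P d w (L i) ξ η) atTop (𝓝 (S.Qstar P d w ξ η))) := by
  obtain ⟨hQs, -⟩ := posSemidef_iff_qform.1 hQ
  obtain ⟨hRs, -⟩ := posSemidef_iff_qform.1 hR.posSemidef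
  have hms := LQRData.meanSquareStationary_of_admissible hnoise hL0
  have hst := hms.discountStable hγ1
  have hiter := hst.isKernelIteration hQ hR hγ0 hγ1
  have hPI := hst.isModelFreePI_iff hnoise hQ hR hγ0 hγ1
  have hstab := hst.gainSeq hQ hR hγ0 hγ1
  have hpsd : ∀ i, (S.costKernel (S.gainSeq L0 i)).PosSemidef := fun i =>
    (hiter.kernel i).posSemidef hQ hR hγ0 (hstab i)
  obtain ⟨Pstar, hlim, hgr⟩ := hiter.exists_limit hst hQ hR hγ0 hγ1
  have hker : S.IsCostKernel (S.gainOf Pstar) Pstar :=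
    ⟨(posSemidef_iff_qform.1 hgr.1).1, (S.sare_iff hQ hR hγ0 hgr.1).1 hgr.2.1⟩
  have hQstar : ∀ (ξ : Ω → Fin n → ℝ) (η : Ω → Fin m → ℝ),
      IsInitial P d w (fun ω => (ξ ω, η ω)) →
      S.Qstar P d w ξ η = ENNReal.ofReal
        (∫ ω, LQRData.quad (S.kernelOf Pstar) (ξ ω) (η ω) ∂P
          + S.γ / (1 - S.γ) * (Pstar * S.W).trace) := fun ξ η hz => by
    -- The optimal cost is taken for the noise from time `1` on; `hms` applies to it because it
    -- involves only the system matrices.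
    rw [LQRData.Qstar, LQRData.Vstar_eq hnoise.shift hQ hR hγ0 hγ1 hms hgr.1 hgr.2.1 hlim
      (LQRData.isInitial_step hnoise hz)]
    exact LQRData.lintegral_cost_add_eq hnoise hQ hR hγ0 hγ1 hgr.1 hz
  refine ⟨⟨(S.gainSeq L0, fun i => S.kernelOf (S.costKernel (S.gainSeq L0 i))),
    (hPI _ _).2 ⟨rfl, rfl⟩, fun LH hLH => Prod.ext ((hPI _ _).1 hLH).1 ((hPI _ _).1 hLH).2⟩,
    Pstar, hgr, fun hQpd => ⟨(LQRData.posDef_of_sare hQpd hR hγ0 hgr.1 hgr.2.1).1,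
      fun P' hP' hs => hgr.eq_of_posDef hQpd hR hγ0 hP' hs⟩, fun ξ hξ => ?_, fun ξ η hz => ?_,
    fun L H hLH => ?_⟩
  · have hV := LQRData.Vstar_eq hnoise hQ hR hγ0 hγ1 hms hgr.1 hgr.2.1 hlim hξ
    exact ⟨(LQRData.V_le_of_isCostKernel hnoise hQ hR hγ0 hγ1 hker hgr.1 hξ).trans_eq hV.symm,
      hV⟩
  · rw [hker.noiseTrace_kernelOf hQs hRs]
    exact hQstar ξ η hz
  · obtain ⟨rfl, rfl⟩ := (hPI _ _).1 hLH
    -- From index `1` on the gains are `gainOf` of convergent kernels, so the initial gain is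
    -- dropped.
    have hgain : Tendsto (S.gainSeq L0) atTop (𝓝 (S.gainOf Pstar)) :=
      (tendsto_add_atTop_iff_nat 1).1
        ((LQRData.continuousAt_gainOf hR hγ0 hgr.1).tendsto.comp hlim)
    have hkernel : Tendsto (fun i => S.kernelOf (S.costKernel (S.gainSeq L0 i))) atTop
        (𝓝 (S.kernelOf Pstar)) :=
      (LQRData.continuous_kernelOf.tendsto Pstar).comp hlim
    refine ⟨fun i => ?_, hgain, hkernel, fun k x => ?_, fun ξ η hz => ?_⟩
    · change (S.kernelOf (S.costKernel (S.gainSeq L0 i))).toBlocks₂₂.PosDef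
      rw [LQRData.kernelOf, Matrix.toBlocks_fromBlocks₂₂]
      exact S.Huu_posDef hR hγ0 (hpsd i)
    · have hc : Continuous fun K : Matrix (Fin m) (Fin n) ℝ => K *ᵥ x := by fun_prop
      exact (hc.tendsto _).comp hgain
    · have hQf := fun i => (hstab i).Qfun_eq hnoise hQ hR hγ0 hγ1 (hiter.kernel i) hz
      refine ⟨fun i => ?_, ?_⟩
      · rw [(hiter.kernel i).noiseTrace_kernelOf hQs hRs]
        exact hQf i
      · rw [hQstar ξ η hz]
        simp only [hQf]
        obtain ⟨hξ, hη⟩ := memLp_prod_iff.1 hz.2.1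
        have hzL : MemLp (fun ω => Sum.elim (ξ ω) (η ω)) 2 P := MemLp.of_eval fun i => by
          rcases i with i | i
          · exact memLp_apply hξ i
          · exact memLp_apply hη i
        have hc : Continuous fun G : Matrix (Fin n) (Fin n) ℝ => (G * S.W).trace := by fun_prop
        exact ENNReal.tendsto_ofReal ((LQRData.tendsto_integral_quad hkernel hzL).add
          (((hc.tendsto Pstar).comp hlim).const_mul _))
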